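/- **Monotonicity formula.** Let $m,n\ge 2$, let $Q$ be a positive integer, and let $\mathbb B_r(x)\subset\mathbb R^m$ be the ball of radius $r$ about $x$. Let $\underline Q(\mathbb R^n)$ be the set of unordered $Q$-tuples $\sum_{i=1}^Q[[p_i]]$ of points of $\mathbb R^n$ with the metric $\mathcal G(\sum[[p_i]],\sum[[q_i]])=\min_\tau(\sum_i|p_i-q_{\tau(i)}|^2)^{1/2}$ ($\tau$ ranging over permutations), and $\underline Q(\mathbb S^{n-1})$ the subset with all $p_i\in\mathbb S^{n-1}$. Let $\xi:\underline Q(\mathbb R^n)\to\mathbb R^N$ be Almgren's bi-Lipschitz embedding (in White's form: for suitable orthonormal bases of $\mathbb R^n$, $K$ in number, it lists in nondecreasing order, for each basis vector $e$, the numbers $\langle p_i,e\rangle$, multiplied by $K^{-1/2}$), and let $\mathcal Y_2(\mathbb B_1(0),\underline Q(\mathbb S^{n-1}))$ be the class of maps $u:\mathbb B_1(0)\to\underline Q(\mathbb S^{n-1})$ with $\xi\circ u\in W^{1,2}(\mathbb B_1(0);\mathbb R^N)$; it does not depend on the choice of bases. Such a $u$ is approximately differentiable at $y$ if $u(y)=\sum[[a_i]]$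 and there are linear maps $L_i:\mathbb R^m\to\mathbb R^n$, with $L_i=L_j$ whenever $a_i=a_j$, such that $\operatorname{ap\,lim}_{z\to y}\mathcal G(u(z),\sum[[a_i+L_i(z-y)]])/|z-y|=0$; then $|D_vu(y)|^2=\sum_i|L_iv|^2$ and $|Du(y)|^2=\sum_{j=1}^m|D_{e_j}u(y)|^2$, where $e_1,\dots,e_m$ is the standard basis of $\mathbb R^m$. The map $u$ is Dir-minimizing if $\int_{\mathbb B_1(0)}|Du|^2\le\int_{\mathbb B_1(0)}|Dv|^2$ for every $v\in\mathcal Y_2(\mathbb B_1(0),\underline Q(\mathbb S^{n-1}))$ that agrees with $u$ a.e. near $\partial\mathbb B_1(0)$ (in particular, every map that minimizes the energy among maps with its own boundary trace is Dir-minimizing). Let $u\in\mathcal Y_2(\mathbb B_1(0),\underline Q(\mathbb S^{n-1}))$ be Dir-minimizing, let $\mathbb B_{\rho_0}(x)\subset\mathbb B_1(0)$ and $0<\sigma<\rho<\rho_0$. Then $u$ is approximately differentiable a.e. in $\mathbb B_1(0)$, the functions integrated below are integrable, and $$\rho^{2-m}\int_{\mathbb B_\rho(x)}|Du|^2-\sigma^{2-m}\int_{\mathbb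 B_\sigma(x)}|Du|^2=2\int_{\mathbb B_\rho(x)\setminus\mathbb B_\sigma(x)}R^{2-m}\left|\frac{\partial u}{\partial R}\right|^2,$$ where $R=|y-x|$ and $|\partial u/\partial R|^2(y)=|D_vu(y)|^2$ with $v=(y-x)/|y-x|$. -/

import Mathlib

open MeasureTheory Filter Topology
open scoped ContDiff ENNReal

noncomputable section

namespace MultiValued

/-- The Euclidean space `ℝ^k`. -/
abbrev E (k : ℕ) : Type := EuclideanSpace ℝ (Fin k)

/-- Unordered `Q`-tuples `∑ [[pᵢ]]` of points of `ℝ^n`, with multiplicity. -/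
abbrev QPoint (Q n : ℕ) : Type := Sym (E n) Q

/-- The `Q`-point `∑ [[aᵢ]]`. -/
def QPoint.ofFn {Q n : ℕ} (a : Fin Q → E n) : QPoint Q n :=
  ⟨Multiset.map a Finset.univ.val, by simp⟩

/-- The metric `𝒢(p, q) = min (∑ |aᵢ - bᵢ|²)^{1/2}`, the minimum being over all enumerations
`a` of `p` and `b` of `q`. -/
def QPoint.gdist {Q n : ℕ} (p q : QPoint Q n) : ℝ :=
  sInf {d : ℝ | ∃ a b : Fin Q → E n,
    p = QPoint.ofFn a ∧ q = QPoint.ofFn b ∧ d = Real.sqrt (∑ i, ‖a i - b i‖ ^ 2)}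

/-- The projections `⟨pᵢ, e⟩` of the points of `p` to the line spanned by `e`, listed in
nondecreasing order. -/
def QPoint.sortedProj {Q n : ℕ} (e : E n) (p : QPoint Q n) (i : Fin Q) : ℝ :=
  (Multiset.sort (Multiset.map (fun z : E n => inner ℝ e z) p.1)).get
    (Fin.cast (by rw [Multiset.length_sort, Multiset.card_map, p.2]) i)

/-- The Almgren–White map `ξ` attached to `K` orthonormal bases of `ℝ^n`: all the ordered
projections of a `Q`-point to the lines spanned by the basis vectors, times `K^{-1/2}`. -/
def xi {K Q n : ℕ} (b : Fin K → OrthonormalBasis (Fin n) ℝ (E n)) (p : QPoint Q n) :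
    EuclideanSpace ℝ (Fin K × Fin n × Fin Q) :=
  WithLp.toLp 2 fun t => (Real.sqrt K)⁻¹ * QPoint.sortedProj (b t.1 t.2.1) p t.2.2

/-- `ξ` is bi-Lipschitz onto its image. -/
def IsBiLipschitz {Q n : ℕ} {F : Type*} [NormedAddCommGroup F] (ξ : QPoint Q n → F) : Prop :=
  ∃ c C : ℝ, 0 < c ∧ 0 < C ∧ ∀ p q : QPoint Q n,
    c * QPoint.gdist p q ≤ ‖ξ p - ξ q‖ ∧ ‖ξ p - ξ q‖ ≤ C * QPoint.gdist p q

/-- `f ∈ W^{1,2}(Ω; F)`: `f` and its weak gradient `g` are square integrable on `Ω`. -/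
def MemW12 {m : ℕ} {F : Type*} [NormedAddCommGroup F] [NormedSpace ℝ F]
    (Ω : Set (E m)) (f : E m → F) : Prop :=
  MemLp f 2 (volume.restrict Ω) ∧
  ∃ g : E m → (E m →L[ℝ] F), MemLp g 2 (volume.restrict Ω) ∧
    ∀ φ : E m → ℝ, ContDiff ℝ ∞ φ → HasCompactSupport φ → tsupport φ ⊆ Ω → ∀ v : E m,
      ∫ y in Ω, (fderiv ℝ φ y v) • f y = - ∫ y in Ω, φ y • g y v

/-- `u ∈ 𝒴₂(Ω, Q(𝕊^{n-1}))`: almost every value of `u` consists of unit vectors, and `ξ ∘ u` is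
in `W^{1,2}(Ω)` for a bi-Lipschitz embedding `ξ` as above (the class does not depend on which). -/
def MemY2Sphere {m Q n : ℕ} (Ω : Set (E m)) (u : E m → QPoint Q n) : Prop :=
  (∀ᵐ y ∂(volume.restrict Ω), ∀ p ∈ u y, ‖p‖ = 1) ∧
  ∃ (K : ℕ) (b : Fin K → OrthonormalBasis (Fin n) ℝ (E n)),
    IsBiLipschitz (xi (Q := Q) b) ∧ MemW12 Ω (fun y => xi b (u y))

/-- `L₁, …, L_Q` is an approximate derivative of `u` at `x`: one can write `u(x) = ∑ [[aᵢ]]` with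
`Lᵢ = Lⱼ` whenever `aᵢ = aⱼ`, and
`ap lim_{y → x} 𝒢(u(y), ∑ [[aᵢ + Lᵢ (y - x)]]) / |y - x| = 0`. -/
def HasApproxDerivAt {m Q n : ℕ} (u : E m → QPoint Q n) (L : Fin Q → (E m →L[ℝ] E n))
    (x : E m) : Prop :=
  ∃ a : Fin Q → E n, u x = QPoint.ofFn a ∧ (∀ i j, a i = a j → L i = L j) ∧
    ∀ ε : ℝ, 0 < ε →
      Tendsto (fun r : ℝ =>
          volume {y ∈ Metric.ball x r |
            ε * ‖y - x‖ < QPoint.gdist (u y) (QPoint.ofFn fun i => a i + L i (y - x))} /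
          volume (Metric.ball x r))
        (𝓝[>] 0) (𝓝 0)

/-- `u` is approximately differentiable at `x`. -/
def ApproxDifferentiableAt {m Q n : ℕ} (u : E m → QPoint Q n) (x : E m) : Prop :=
  ∃ L : Fin Q → (E m →L[ℝ] E n), HasApproxDerivAt u L x

open Classical in
/-- The approximate derivative of `u` at `x` (unique up to the order of the `Lᵢ`); zero where
`u` is not approximately differentiable. -/
def approxDeriv {m Q n : ℕ} (u : E m → QPoint Q n) (x : E m) : Fin Q → (E m →L[ℝ] E n) :=
  if h : ApproxDifferentiableAt u x then h.choose else 0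

/-- `|D_v u(x)|² = ∑ᵢ |Lᵢ v|²`. -/
def dirDerivSq {m Q n : ℕ} (u : E m → QPoint Q n) (x v : E m) : ℝ :=
  ∑ i, ‖approxDeriv u x i v‖ ^ 2

/-- `|Du(x)|²`, the sum of `|D_v u(x)|²` over the standard basis. -/
def derivSq {m Q n : ℕ} (u : E m → QPoint Q n) (x : E m) : ℝ :=
  ∑ j : Fin m, dirDerivSq u x (EuclideanSpace.single j 1)

/-- `|∂u/∂R|²` at `y`, for the radial direction `(y - x) / |y - x|`. -/
def radialDerivSq {m Q n : ℕ} (u : E m → QPoint Q n) (x y : E m) : ℝ :=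
  dirDerivSq u y (‖y - x‖⁻¹ • (y - x))

/-- The Dirichlet energy `Dir(u; A) = ∫_A |Du|²`. -/
def dirEnergy {m Q n : ℕ} (u : E m → QPoint Q n) (A : Set (E m)) : ℝ≥0∞ :=
  ∫⁻ y in A, ENNReal.ofReal (derivSq u y)

/-- `u : 𝔹₁ → Q(𝕊^{n-1})` is Dirichlet minimizing: it has least energy among all maps of the same
class that agree with it near `∂𝔹₁`. (A minimizer among all maps with the same trace on `∂𝔹₁` is
one in this sense.) -/
def IsDirMinimizing {m Q n : ℕ} (u : E m → QPoint Q n) : Prop :=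
  MemY2Sphere (Metric.ball 0 1) u ∧
  ∀ v : E m → QPoint Q n, MemY2Sphere (Metric.ball 0 1) v →
    (∃ r : ℝ, r < 1 ∧
      ∀ᵐ y ∂(volume.restrict (Metric.ball (0 : E m) 1 \ Metric.ball 0 r)), v y = u y) →
    dirEnergy u (Metric.ball 0 1) ≤ dirEnergy v (Metric.ball 0 1)

end MultiValued

end

/-
Write `f = ξ ∘ u`. At almost every point the Sobolev map `f` is approximately differentiable, and
since `ξ` lists sorted projections on orthonormal bases, the `Q` sheets of `u` inherit approximate
derivatives with `|D_v u|² = |D_v f|²`. So the energy is that of a Sobolev map into a Euclidean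
space. Composing `u` with a diffeomorphism supported in the domain keeps the values in the target,
so the energy is stationary under such changes of variable:
`∫ (|Df|² div X - 2 ∑ⱼ ⟨D_{e_j} f, D_{D_{e_j} X} f⟩) = 0` for every test field `X`. For the radial
field `X = η(R²) (y - x)`, where `-2 η'(R²)` is `R^{-m}` on the annulus `σ < R < ρ` and zero
elsewhere, this identity is the monotonicity formula itself. This `η` is only Lipschitz and is
reached by smooth approximation.
-/

namespace MultiValued

section QPoint

variable {Q n : ℕ}

theorem exists_perm_of_map_univ_eq {ι α : Type*} [Fintype ι] {a b : ι → α}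
    (h : Multiset.map a Finset.univ.val = Multiset.map b Finset.univ.val) :
    ∃ τ : Equiv.Perm ι, ∀ i, b (τ i) = a i := by
  classical
  have fiberEquiv (c : α) : Nonempty ({i // a i = c} ≃ {i // b i = c}) := by
    rw [← Fintype.card_eq, Fintype.card_subtype, Fintype.card_subtype]
    simpa [Multiset.count_map, Finset.card, Finset.filter, eq_comm] using
      congrArg (Multiset.count c) h
  exact ⟨Equiv.ofFiberEquiv fun c => (fiberEquiv c).some, Equiv.ofFiberEquiv_map _⟩

namespace QPoint

theorem exists_eq_ofFn (p : QPoint Q n) : ∃ a : Fin Q → E n, p = ofFn a := by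
  obtain ⟨s, hs⟩ := p
  induction s using Quotient.inductionOn with
  | h l =>
    obtain rfl : l.length = Q := hs
    exact ⟨l.get, Subtype.ext <| by simp [ofFn, Fin.univ_val_map]⟩

theorem exists_perm_of_ofFn_eq {a b : Fin Q → E n} (h : ofFn a = ofFn b) :
    ∃ τ : Equiv.Perm (Fin Q), ∀ i, b (τ i) = a i :=
  exists_perm_of_map_univ_eq (congrArg Subtype.val h)

theorem ofFn_comp_perm (a : Fin Q → E n) (τ : Equiv.Perm (Fin Q)) :
    ofFn (fun i => a (τ i)) = ofFn a :=
  Subtype.ext <| by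
    simp only [ofFn]
    conv_rhs => rw [← Multiset.map_univ_val_equiv τ, Multiset.map_map]
    rfl

theorem gdist_ofFn_le (a b : Fin Q → E n) :
    gdist (ofFn a) (ofFn b) ≤ √(∑ i, ‖a i - b i‖ ^ 2) :=
  csInf_le ⟨0, by rintro _ ⟨a, b, -, -, rfl⟩; exact Real.sqrt_nonneg _⟩ ⟨a, b, rfl, rfl, rfl⟩

theorem gdist_ofFn_le_sum (a b : Fin Q → E n) :
    gdist (ofFn a) (ofFn b) ≤ ∑ i, ‖a i - b i‖ := by
  refine (gdist_ofFn_le a b).trans ?_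
  rw [Real.sqrt_le_left (Finset.sum_nonneg fun _ _ => norm_nonneg _)]
  exact Finset.sum_sq_le_sq_sum_of_nonneg fun i _ => norm_nonneg _

theorem gdist_nonneg (p q : QPoint Q n) : 0 ≤ gdist p q := by
  refine Real.sInf_nonneg ?_
  rintro _ ⟨a, b, -, -, rfl⟩
  exact Real.sqrt_nonneg _

theorem gdist_self (p : QPoint Q n) : gdist p p = 0 := by
  obtain ⟨a, rfl⟩ := p.exists_eq_ofFn
  exact le_antisymm (by simpa using gdist_ofFn_le a a) (gdist_nonneg _ _)

theorem exists_eq_ofFn_gdist_eq (p : QPoint Q n) (a : Fin Q → E n) :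
    ∃ b : Fin Q → E n, p = ofFn b ∧ gdist p (ofFn a) = √(∑ i, ‖b i - a i‖ ^ 2) := by
  obtain ⟨c, rfl⟩ := p.exists_eq_ofFn
  set D : Set ℝ := {d | ∃ c' a' : Fin Q → E n, ofFn c = ofFn c' ∧ ofFn a = ofFn a' ∧
    d = √(∑ i, ‖c' i - a' i‖ ^ 2)}
  have D_subset : D ⊆ Set.range fun τ : Equiv.Perm (Fin Q) => √(∑ i, ‖c (τ i) - a i‖ ^ 2) := by
    rintro _ ⟨c', a', hc, ha, rfl⟩
    obtain ⟨τ, hτ⟩ := exists_perm_of_ofFn_eq hc.symm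
    obtain ⟨π, hπ⟩ := exists_perm_of_ofFn_eq ha
    refine ⟨π.trans τ, ?_⟩
    rw [← Equiv.sum_comp π fun i => ‖c' i - a' i‖ ^ 2]
    simp [hτ, hπ]
  have sInf_mem : sInf D ∈ D :=
    Set.Nonempty.csInf_mem ⟨_, c, a, rfl, rfl, rfl⟩ ((Set.finite_range _).subset D_subset)
  obtain ⟨τ, hτ⟩ := D_subset sInf_mem
  exact ⟨fun i => c (τ i), (ofFn_comp_perm c τ).symm, hτ.symm⟩

theorem norm_sub_le_gdist {p : QPoint Q n} {a b : Fin Q → E n}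
    (h : gdist p (ofFn a) = √(∑ i, ‖b i - a i‖ ^ 2)) (i : Fin Q) :
    ‖b i - a i‖ ≤ gdist p (ofFn a) := by
  rw [h]
  exact Real.le_sqrt_of_sq_le <|
    Finset.single_le_sum (f := fun i => ‖b i - a i‖ ^ 2) (fun _ _ => sq_nonneg _)
      (Finset.mem_univ i)

theorem eq_of_gdist_eq_zero {p q : QPoint Q n} (h : gdist p q = 0) : p = q := by
  obtain ⟨a, rfl⟩ := q.exists_eq_ofFn
  obtain ⟨b, rfl, hb⟩ := p.exists_eq_ofFn_gdist_eq a
  congr 1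
  exact funext fun i => sub_eq_zero.1 <| norm_le_zero_iff.1 (h ▸ norm_sub_le_gdist hb i)

theorem exists_tendsto_selection {X : Type*} {l : Filter X} {u : X → QPoint Q n} {x : X}
    (h : Tendsto (fun z => gdist (u z) (u x)) l (𝓝 0)) :
    ∃ p : X → Fin Q → E n, (∀ z, u z = ofFn (p z)) ∧
      ∀ i, Tendsto (fun z => p z i) l (𝓝 (p x i)) := by
  obtain ⟨a, ha⟩ := (u x).exists_eq_ofFn
  choose p hup hp using fun z => exists_eq_ofFn_gdist_eq (u z) a
  have norm_sub_le (z : X) (i : Fin Q) : ‖p z i - a i‖ ≤ gdist (u z) (u x) := by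
    rw [ha]; exact norm_sub_le_gdist (hp z) i
  have hpx : p x = a := funext fun i => by
    simpa [gdist_self, sub_eq_zero] using norm_sub_le x i
  refine ⟨p, hup, fun i => ?_⟩
  rw [hpx, tendsto_iff_norm_sub_tendsto_zero]
  exact squeeze_zero (fun _ => norm_nonneg _) (norm_sub_le · i) h

theorem monotone_sortedProj (e : E n) (p : QPoint Q n) : Monotone (sortedProj e p) := fun _ _ hij =>
  (List.sortedLE_iff_pairwise.2 (Multiset.pairwise_sort _ _)).monotone_get hij

theorem exists_perm_sortedProj (e : E n) (a : Fin Q → E n) :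
    ∃ τ : Equiv.Perm (Fin Q), ∀ i, sortedProj e (ofFn a) (τ i) = inner ℝ e (a i) := by
  refine exists_perm_of_map_univ_eq ?_
  set s : Multiset ℝ := Multiset.map (fun z : E n => inner ℝ e z) (ofFn a).1
  calc Multiset.map (fun i => inner ℝ e (a i)) Finset.univ.val
    _ = s := by simp [s, ofFn, Function.comp_def]
    _ = Multiset.sort s := (Multiset.sort_eq s (· ≤ ·)).symm
    _ = Multiset.map (sortedProj e (ofFn a)) Finset.univ.val := by
      rw [Fin.univ_val_map]
      congr 1
      refine List.ext_get (by simp [s, ofFn]) fun k h1 h2 => ?_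
      simp only [s, List.get_eq_getElem, List.getElem_ofFn, sortedProj, Fin.val_cast]

end QPoint

end QPoint

section ApproximateLimit

open Metric Module

/-- The approximate neighbourhood filter: the sets whose complement has `μ`-density zero at `y`, so
that approximate limits at `y` are limits along it. -/
def apNhds {X : Type*} [PseudoMetricSpace X] [MeasurableSpace X] (μ : Measure X) (y : X) :
    Filter X where
  sets := {S | Tendsto (fun r : ℝ => μ (Sᶜ ∩ ball y r) / μ (ball y r)) (𝓝[>] 0) (𝓝 0)}
  univ_sets := by simp
  sets_of_superset {S T} hS hST := by
    refine tendsto_of_tendsto_of_tendsto_of_le_of_le tendsto_const_nhds hS (fun _ => bot_le)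
      fun r => ?_
    dsimp only
    gcongr
  inter_sets {S T} hS hT := by
    refine tendsto_of_tendsto_of_tendsto_of_le_of_le tendsto_const_nhds
      (by simpa using Tendsto.add hS hT) (fun _ => bot_le) fun r => ?_
    dsimp only
    rw [← ENNReal.add_div, Set.compl_inter, Set.union_inter_distrib_right]
    gcongr
    exact measure_union_le _ _

section MetricSpace

variable {X : Type*} [PseudoMetricSpace X] [MeasurableSpace X] {μ : Measure X} {y : X}

theorem eventually_apNhds_iff {P : X → Prop} :
    (∀ᶠ z in apNhds μ y, P z) ↔
      Tendsto (fun r : ℝ => μ {z ∈ ball y r | ¬ P z} / μ (ball y r)) (𝓝[>] 0) (𝓝 0) := by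
  have setOf_compl_inter (r : ℝ) : {z | P z}ᶜ ∩ ball y r = {z ∈ ball y r | ¬ P z} := by
    ext z; simp [and_comm]
  simp only [← setOf_compl_inter]
  rfl

theorem apNhds_le_nhds : apNhds μ y ≤ 𝓝 y := by
  intro S hS
  obtain ⟨ε, hε, ball_subset⟩ := Metric.mem_nhds_iff.1 hS
  refine Tendsto.congr' (f₁ := fun _ => 0) ?_ tendsto_const_nhds
  filter_upwards [Ioo_mem_nhdsGT hε] with r hr
  have inter_eq_empty : Sᶜ ∩ ball y r = ∅ :=
    (Set.disjoint_compl_left_iff_subset.2 ((ball_subset_ball hr.2.le).trans ball_subset)).inter_eq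
  simp [inter_eq_empty]

end MetricSpace

variable {V F : Type*} [NormedAddCommGroup V] [NormedSpace ℝ V] [MeasurableSpace V]
  [NormedAddCommGroup F] [NormedSpace ℝ F] {μ : Measure V} {y : V}

section Cone

open scoped Pointwise

variable [BorelSpace V] [FiniteDimensional ℝ V] [μ.IsAddHaarMeasure]

theorem addHaar_ball_inter_cone {C : Set V} (hC : ∀ t : ℝ, 0 < t → ∀ v, t • v ∈ C ↔ v ∈ C)
    (y : V) {r : ℝ} (hr : 0 < r) :
    μ {z ∈ ball y r | z - y ∈ C} = ENNReal.ofReal (r ^ finrank ℝ V) * μ (ball 0 1 ∩ C) := by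
  rw [← Measure.addHaar_smul_of_nonneg μ hr.le,
    ← measure_preimage_add_right μ (-y) (r • (ball 0 1 ∩ C))]
  congr 1
  ext z
  simp only [Set.mem_ofPred_eq, Set.mem_preimage, Set.mem_smul_set_iff_inv_smul_mem₀ hr.ne',
    Set.mem_inter_iff, hC _ (inv_pos.2 hr), mem_ball_iff_norm, sub_zero, norm_smul,
    norm_inv, Real.norm_of_nonneg hr.le, inv_mul_lt_one₀ hr, ← sub_eq_add_neg]

theorem frequently_apNhds_sub_mem_cone {C : Set V} (hCo : IsOpen C) (hCne : C.Nonempty)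
    (hC : ∀ t : ℝ, 0 < t → ∀ v, t • v ∈ C ↔ v ∈ C) : ∃ᶠ z in apNhds μ y, z - y ∈ C := by
  intro h
  simp only [eventually_apNhds_iff, not_not] at h
  have density_eq : ∀ᶠ r : ℝ in 𝓝[>] 0,
      μ {z ∈ ball y r | z - y ∈ C} / μ (ball y r) = μ (ball 0 1 ∩ C) / μ (ball 0 1) := by
    filter_upwards [self_mem_nhdsWithin] with r (hr : 0 < r)
    rw [addHaar_ball_inter_cone hC y hr, Measure.addHaar_ball_of_pos μ y hr]
    exact ENNReal.mul_div_mul_left _ _ (ENNReal.ofReal_pos.2 (by positivity)).ne'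
      ENNReal.ofReal_ne_top
  have measure_eq_zero : μ (ball 0 1 ∩ C) = 0 := by
    have := tendsto_nhds_unique (h.congr' density_eq) tendsto_const_nhds
    simpa [ENNReal.div_eq_zero_iff, measure_ball_lt_top.ne] using this.symm
  obtain ⟨v, hv⟩ := hCne
  have smul_mem : ((‖v‖ + 1)⁻¹ : ℝ) • v ∈ ball 0 1 ∩ C := by
    refine ⟨?_, (hC _ (by positivity) v).2 hv⟩
    rw [mem_ball_zero_iff, norm_smul, norm_inv, Real.norm_of_nonneg (by positivity),
      inv_mul_lt_one₀ (by positivity)]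
    exact lt_add_one _
  exact (isOpen_ball.inter hCo).measure_ne_zero μ ⟨_, smul_mem⟩ measure_eq_zero

/-- A linear functional that is nonnegative to first order on a set of full density vanishes: it
would otherwise be negative on an open cone. -/
theorem eq_zero_of_eventually_apNhds_nonneg {l : V →L[ℝ] ℝ}
    (h : ∀ ε : ℝ, 0 < ε → ∀ᶠ z in apNhds μ y, -(ε * ‖z - y‖) ≤ l (z - y)) : l = 0 := by
  have nonneg (w : V) : 0 ≤ l w := by
    by_contra! hw
    obtain ⟨ε, hε, hεw⟩ : ∃ ε : ℝ, 0 < ε ∧ ε * ‖w‖ < -l w :=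
      exists_pos_mul_lt (neg_pos.2 hw) _ |>.imp fun ε h => by rwa [mul_comm ε]
    have isOpen_cone : IsOpen {v : V | l v < -(ε * ‖v‖)} :=
      isOpen_lt l.continuous (by fun_prop)
    refine frequently_apNhds_sub_mem_cone (μ := μ) (y := y) isOpen_cone
      ⟨w, lt_neg_of_lt_neg hεw⟩ (fun t ht v => ?_) ((h ε hε).mono fun z hz => not_lt.2 hz)
    simp only [Set.mem_ofPred_eq, map_smul, smul_eq_mul, norm_smul, Real.norm_of_nonneg ht.le]
    rw [mul_left_comm, ← mul_neg, mul_lt_mul_iff_right₀ ht]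
  refine ContinuousLinearMap.ext fun w => le_antisymm ?_ (nonneg w)
  simpa using nonneg (-w)

end Cone

/-- `f` has the approximate Fréchet derivative `f'` at `y`. -/
def HasApproxFDerivAt (μ : Measure V) (f : V → F) (f' : V →L[ℝ] F) (y : V) : Prop :=
  HasFDerivAtFilter f f' (apNhds μ y ×ˢ pure y)

theorem hasApproxFDerivAt_iff_isLittleO {f : V → F} {f' : V →L[ℝ] F} :
    HasApproxFDerivAt μ f f' y ↔
      (fun z => f z - f y - f' (z - y)) =o[apNhds μ y] fun z => z - y := by
  rw [HasApproxFDerivAt, hasFDerivAtFilter_iff_isLittleO, prod_pure, Asymptotics.isLittleO_map]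
  rfl

namespace HasApproxFDerivAt

variable {f g : V → F} {f' : V →L[ℝ] F}

theorem tendsto (h : HasApproxFDerivAt μ f f' y) : Tendsto f (apNhds μ y) (𝓝 (f y)) :=
  HasFDerivAtFilter.tendsto_nhds apNhds_le_nhds h

theorem clm_comp {G : Type*} [NormedAddCommGroup G] [NormedSpace ℝ G] (l : F →L[ℝ] G)
    (h : HasApproxFDerivAt μ f f' y) : HasApproxFDerivAt μ (fun z => l (f z)) (l.comp f') y :=
  l.hasFDerivAtFilter.comp h tendsto_map

theorem congr_isLittleO (h : HasApproxFDerivAt μ f f' y) (hy : f y = g y)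
    (hfg : (fun z => f z - g z) =o[apNhds μ y] fun z => z - y) : HasApproxFDerivAt μ g f' y := by
  rw [hasApproxFDerivAt_iff_isLittleO] at h ⊢
  refine (h.sub hfg).congr_left fun z => ?_
  rw [hy]
  abel

theorem eq_of_le [BorelSpace V] [FiniteDimensional ℝ V] [μ.IsAddHaarMeasure] {f g : V → ℝ}
    {f' g' : V →L[ℝ] ℝ} (hf : HasApproxFDerivAt μ f f' y) (hg : HasApproxFDerivAt μ g g' y)
    (hle : ∀ z, f z ≤ g z) (hy : f y = g y) : f' = g' := by
  refine (sub_eq_zero.1 (eq_zero_of_eventually_apNhds_nonneg (μ := μ) (y := y) fun ε hε => ?_)).symm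
  filter_upwards [(hasApproxFDerivAt_iff_isLittleO.1 (HasFDerivAtFilter.sub hg hf)).def hε]
    with z hz
  simp only [Pi.sub_apply, hy, sub_self, sub_zero, Real.norm_eq_abs, abs_le] at hz
  linarith [hle z]

end HasApproxFDerivAt

end ApproximateLimit

section SortedProjection

variable {V : Type*} [NormedAddCommGroup V] [NormedSpace ℝ V] [MeasurableSpace V] [BorelSpace V]
  [FiniteDimensional ℝ V] {μ : Measure V} [μ.IsAddHaarMeasure] {Q n K : ℕ} {y : V}

theorem sortedProj_deriv_eq {u : V → QPoint Q n} {e : E n} {G : Fin Q → V →L[ℝ] ℝ}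
    (h : ∀ s, HasApproxFDerivAt μ (fun z => (u z).sortedProj e s) (G s) y) {s t : Fin Q}
    (hst : (u y).sortedProj e s = (u y).sortedProj e t) : G s = G t := by
  wlog hle : s ≤ t generalizing s t
  · exact (this hst.symm (le_of_not_ge hle)).symm
  exact (h s).eq_of_le (h t) (fun z => (u z).monotone_sortedProj e hle) hst

theorem HasApproxFDerivAt.inner_of_sortedProj {p : V → Fin Q → E n} {e : E n}
    {G : Fin Q → V →L[ℝ] ℝ} (hp : ∀ i, Tendsto (fun z => p z i) (apNhds μ y) (𝓝 (p y i)))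
    (h : ∀ s, HasApproxFDerivAt μ (fun z => (QPoint.ofFn (p z)).sortedProj e s) (G s) y)
    {i s : Fin Q} (his : (QPoint.ofFn (p y)).sortedProj e s = inner ℝ e (p y i)) :
    HasApproxFDerivAt μ (fun z => inner ℝ e (p z i)) (G s) y := by
  -- Near `y`, only those positions can hold `⟨p z i, e⟩` whose value at `y` is `⟨p y i, e⟩`,
  -- and these all have the derivative `G s`.
  have position_eventually : ∀ᶠ z in apNhds μ y, ∀ t,
      (QPoint.ofFn (p z)).sortedProj e t = inner ℝ e (p z i) →
        (QPoint.ofFn (p y)).sortedProj e t = inner ℝ e (p y i) := by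
    refine eventually_all.2 fun t => ?_
    by_cases ht : (QPoint.ofFn (p y)).sortedProj e t = inner ℝ e (p y i)
    · exact Eventually.of_forall fun _ _ => ht
    · filter_upwards [((h t).tendsto.sub (tendsto_const_nhds.inner (hp i))).eventually_ne
        (sub_ne_zero.2 ht)] with z hz hzt
      exact absurd (sub_eq_zero.2 hzt) hz
  rw [hasApproxFDerivAt_iff_isLittleO, Asymptotics.isLittleO_iff]
  intro ε hε
  filter_upwards [eventually_all.2 fun t => (hasApproxFDerivAt_iff_isLittleO.1 (h t)).def hε,
    position_eventually] with z hz position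
  obtain ⟨τ, hτ⟩ := QPoint.exists_perm_sortedProj e (p z)
  have hτy := position (τ i) (hτ i)
  have expansion := hz (τ i)
  rwa [hτ i, hτy, sortedProj_deriv_eq h (hτy.trans his.symm)] at expansion

/-- The component of an `ℝ^N`-valued linear map `G` at the `s`-th sorted projection to the `j`-th
vector of the `k`-th basis, without the normalization `K^{-1/2}` of `ξ`. -/
noncomputable def sortedDeriv (G : V →L[ℝ] EuclideanSpace ℝ (Fin K × Fin n × Fin Q)) (k : Fin K)
    (j : Fin n) (s : Fin Q) : V →L[ℝ] ℝ :=
  √K • (EuclideanSpace.proj (k, j, s)).comp G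

variable {b : Fin K → OrthonormalBasis (Fin n) ℝ (E n)}
  {G : V →L[ℝ] EuclideanSpace ℝ (Fin K × Fin n × Fin Q)}

omit [BorelSpace V] [FiniteDimensional ℝ V] [μ.IsAddHaarMeasure] in
theorem HasApproxFDerivAt.sortedProj {u : V → QPoint Q n}
    (h : HasApproxFDerivAt μ (fun z => xi b (u z)) G y) (k : Fin K) (j : Fin n) (s : Fin Q) :
    HasApproxFDerivAt μ (fun z => (u z).sortedProj (b k j) s) (sortedDeriv G k j s) y := by
  have hK : √(K : ℝ) ≠ 0 := (Real.sqrt_pos.2 (Nat.cast_pos.2 (Fin.pos k))).ne'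
  have proj_xi (z : V) : (√K • EuclideanSpace.proj (k, j, s) :
      EuclideanSpace ℝ (Fin K × Fin n × Fin Q) →L[ℝ] ℝ) (xi b (u z)) =
        (u z).sortedProj (b k j) s := by
    simp [xi, hK]
  have hcomp := h.clm_comp (√(K : ℝ) • EuclideanSpace.proj (k, j, s))
  simp only [proj_xi] at hcomp
  exact hcomp

section Selection

variable {p : V → Fin Q → E n}

theorem HasApproxFDerivAt.inner_selection
    (h : HasApproxFDerivAt μ (fun z => xi b (QPoint.ofFn (p z))) G y)
    (hp : ∀ i, Tendsto (fun z => p z i) (apNhds μ y) (𝓝 (p y i))) {k : Fin K} {j : Fin n}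
    {i s : Fin Q} (his : (QPoint.ofFn (p y)).sortedProj (b k j) s = inner ℝ (b k j) (p y i)) :
    HasApproxFDerivAt μ (fun z => inner ℝ (b k j) (p z i)) (sortedDeriv G k j s) y :=
  .inner_of_sortedProj hp (h.sortedProj k j) his

theorem HasApproxFDerivAt.exists_selection_deriv [NeZero K]
    (h : HasApproxFDerivAt μ (fun z => xi b (QPoint.ofFn (p z))) G y)
    (hp : ∀ i, Tendsto (fun z => p z i) (apNhds μ y) (𝓝 (p y i))) :
    ∃ L : Fin Q → V →L[ℝ] E n, (∀ i, HasApproxFDerivAt μ (fun z => p z i) (L i) y) ∧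
      ∀ i i', p y i = p y i' → L i = L i' := by
  have exists_position (j : Fin n) (i : Fin Q) : ∃ s,
      (QPoint.ofFn (p y)).sortedProj (b 0 j) s = inner ℝ (b 0 j) (p y i) :=
    (QPoint.exists_perm_sortedProj (b 0 j) (p y)).elim fun τ hτ => ⟨τ i, hτ i⟩
  choose s hs using exists_position
  refine ⟨fun i => ∑ j, (sortedDeriv G 0 j (s j i)).smulRight (b 0 j), fun i => ?_,
    fun i i' hii => ?_⟩
  · have hsum : HasApproxFDerivAt μ (fun z => ∑ j, (inner ℝ (b 0 j) (p z i) : ℝ) • b 0 j)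
        (∑ j, (sortedDeriv G 0 j (s j i)).smulRight (b 0 j)) y :=
      HasFDerivAtFilter.fun_sum fun j _ =>
        (h.inner_selection hp (hs j i)).clm_comp (.smulRight (.id ℝ ℝ) (b 0 j))
    simpa only [(b 0).sum_repr'] using hsum
  · refine Finset.sum_congr rfl fun j _ => ?_
    rw [sortedProj_deriv_eq (h.sortedProj 0 j) (s := s j i) (t := s j i')
      (by rw [hs, hs, hii])]

theorem sum_norm_sq_eq_of_hasApproxFDerivAt_xi [NeZero K]
    (h : HasApproxFDerivAt μ (fun z => xi b (QPoint.ofFn (p z))) G y)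
    {L : Fin Q → V →L[ℝ] E n} (hL : ∀ i, HasApproxFDerivAt μ (fun z => p z i) (L i) y) (v : V) :
    ∑ i, ‖L i v‖ ^ 2 = ‖G v‖ ^ 2 := by
  have sum_inner_sq (k : Fin K) (j : Fin n) :
      ∑ i, (inner ℝ (b k j) (L i v) : ℝ) ^ 2 = K * ∑ s, G v (k, j, s) ^ 2 := by
    obtain ⟨τ, hτ⟩ := QPoint.exists_perm_sortedProj (b k j) (p y)
    rw [← Equiv.sum_comp τ fun s => G v (k, j, s) ^ 2, Finset.mul_sum]
    refine Finset.sum_congr rfl fun i _ => ?_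
    have deriv_eq : (innerSL ℝ (b k j)).comp (L i) = sortedDeriv G k j (τ i) :=
      ((hL i).clm_comp (innerSL ℝ (b k j))).eq_of_le
        (h.inner_selection (fun i => (hL i).tendsto) (hτ i)) (fun _ => le_rfl) rfl
    have inner_eq : inner ℝ (b k j) (L i v) = √K * G v (k, j, τ i) := by
      simpa [sortedDeriv] using DFunLike.congr_fun deriv_eq v
    rw [inner_eq, mul_pow, Real.sq_sqrt (Nat.cast_nonneg K)]
  have sum_norm_sq (k : Fin K) : ∑ i, ‖L i v‖ ^ 2 = K * ∑ j, ∑ s, G v (k, j, s) ^ 2 := by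
    simp_rw [Finset.mul_sum, ← Finset.mul_sum (Finset.univ : Finset (Fin Q)), ← sum_inner_sq]
    rw [Finset.sum_comm]
    refine Finset.sum_congr rfl fun i _ => ?_
    simp [← (b k).sum_sq_norm_inner_right (L i v)]
  refine mul_left_cancel₀ (Nat.cast_ne_zero (R := ℝ).2 (NeZero.ne K)) ?_
  calc K * ∑ i, ‖L i v‖ ^ 2
    _ = ∑ _k : Fin K, ∑ i, ‖L i v‖ ^ 2 := by simp
    _ = K * ∑ k, ∑ j, ∑ s, G v (k, j, s) ^ 2 := by
      rw [Finset.sum_congr rfl fun k _ => sum_norm_sq k, ← Finset.mul_sum]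
    _ = K * ‖G v‖ ^ 2 := by simp [EuclideanSpace.norm_sq_eq, Fintype.sum_prod_type]

end Selection

end SortedProjection

section ApproxDeriv

variable {m n Q K : ℕ} {u : E m → QPoint Q n} {y : E m}
  {b : Fin K → OrthonormalBasis (Fin n) ℝ (E n)}
  {G : E m →L[ℝ] EuclideanSpace ℝ (Fin K × Fin n × Fin Q)} {L : Fin Q → E m →L[ℝ] E n}

theorem hasApproxDerivAt_iff_isLittleO : HasApproxDerivAt u L y ↔
    ∃ a : Fin Q → E n, u y = QPoint.ofFn a ∧ (∀ i j, a i = a j → L i = L j) ∧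
      (fun z => (u z).gdist (QPoint.ofFn fun i => a i + L i (z - y)))
        =o[apNhds volume y] fun z => z - y := by
  refine exists_congr fun a => and_congr_right fun _ => and_congr_right fun _ => ?_
  simp [Asymptotics.isLittleO_iff, eventually_apNhds_iff, abs_of_nonneg (QPoint.gdist_nonneg _ _)]

theorem hasApproxDerivAt_of_selection {p : E m → Fin Q → E n} (hup : ∀ z, u z = QPoint.ofFn (p z))
    (hL : ∀ i, HasApproxFDerivAt volume (fun z => p z i) (L i) y)
    (htie : ∀ i j, p y i = p y j → L i = L j) : HasApproxDerivAt u L y := by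
  refine hasApproxDerivAt_iff_isLittleO.2 ⟨p y, hup y, htie, ?_⟩
  refine Asymptotics.IsBigO.trans_isLittleO (.of_bound 1 <| .of_forall fun z => ?_)
    (Asymptotics.IsLittleO.sum (s := Finset.univ) fun i _ =>
      (hasApproxFDerivAt_iff_isLittleO.1 (hL i)).norm_left)
  rw [Finset.sum_apply, one_mul, Real.norm_of_nonneg (QPoint.gdist_nonneg _ _),
    Real.norm_of_nonneg (Finset.sum_nonneg fun _ _ => norm_nonneg _), hup z]
  simpa only [sub_sub] using QPoint.gdist_ofFn_le_sum (p z) fun i => p y i + L i (z - y)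

theorem approxDifferentiableAt_of_xi [NeZero K] (hb : IsBiLipschitz (xi (Q := Q) b))
    (hG : HasApproxFDerivAt volume (fun z => xi b (u z)) G y) : ApproxDifferentiableAt u y := by
  obtain ⟨c, C, hc, -, hcC⟩ := hb
  have tendsto_gdist : Tendsto (fun z => (u z).gdist (u y)) (apNhds volume y) (𝓝 0) := by
    refine squeeze_zero (fun z => QPoint.gdist_nonneg _ _) (fun z => ?_)
      (by simpa using (tendsto_iff_norm_sub_tendsto_zero.1 hG.tendsto).const_mul c⁻¹)
    rw [inv_mul_eq_div, le_div_iff₀' hc]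
    exact (hcC _ _).1
  obtain ⟨p, hup, hp⟩ := QPoint.exists_tendsto_selection tendsto_gdist
  simp only [hup] at hG
  obtain ⟨L, hL, htie⟩ := hG.exists_selection_deriv hp
  exact ⟨L, hasApproxDerivAt_of_selection hup hL htie⟩

theorem HasApproxDerivAt.sum_norm_sq_eq [NeZero K] (hb : IsBiLipschitz (xi (Q := Q) b))
    (hL : HasApproxDerivAt u L y) (hG : HasApproxFDerivAt volume (fun z => xi b (u z)) G y)
    (v : E m) : ∑ i, ‖L i v‖ ^ 2 = ‖G v‖ ^ 2 := by
  obtain ⟨a, ha, -, hLa⟩ := hasApproxDerivAt_iff_isLittleO.1 hL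
  obtain ⟨c, C, -, -, hcC⟩ := hb
  have xi_isLittleO : (fun z => xi b (u z) - xi b (QPoint.ofFn fun i => a i + L i (z - y)))
      =o[apNhds volume y] fun z => z - y := by
    refine Asymptotics.IsBigO.trans_isLittleO (.of_bound C <| .of_forall fun z => ?_) hLa
    rw [Real.norm_of_nonneg (QPoint.gdist_nonneg _ _)]
    exact (hcC _ _).2
  refine sum_norm_sq_eq_of_hasApproxFDerivAt_xi
    (hG.congr_isLittleO (by simp [ha]) xi_isLittleO) (fun i => ?_) v
  exact hasApproxFDerivAt_iff_isLittleO.2 (by simp)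

theorem dirDerivSq_eq_of_xi [NeZero K] (hb : IsBiLipschitz (xi (Q := Q) b))
    (hG : HasApproxFDerivAt volume (fun z => xi b (u z)) G y) (v : E m) :
    dirDerivSq u y v = ‖G v‖ ^ 2 := by
  have hdiff := approxDifferentiableAt_of_xi hb hG
  rw [dirDerivSq, approxDeriv, dif_pos hdiff]
  exact hdiff.choose_spec.sum_norm_sq_eq hb hG v

theorem IsBiLipschitz.neZero_of_xi [Nontrivial (QPoint Q n)] (hb : IsBiLipschitz (xi (Q := Q) b)) :
    NeZero K := by
  refine ⟨?_⟩
  rintro rfl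
  obtain ⟨c, C, hc, -, hcC⟩ := hb
  refine not_subsingleton (QPoint Q n) ⟨fun p q => ?_⟩
  have gdist_eq_zero : p.gdist q = 0 := by
    have := (hcC p q).1
    rw [Subsingleton.elim (xi b p) (xi b q), sub_self, norm_zero] at this
    exact le_antisymm (nonpos_of_mul_nonpos_right this hc) (QPoint.gdist_nonneg p q)
  exact QPoint.eq_of_gdist_eq_zero gdist_eq_zero

end ApproxDeriv

section BallAverage

open Metric Module

variable {V F : Type*} [NormedAddCommGroup V] [NormedSpace ℝ V] [MeasurableSpace V] [BorelSpace V]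
  [FiniteDimensional ℝ V] [NormedAddCommGroup F] {μ : Measure V} {y : V}

theorem hasApproxFDerivAt_of_tendsto_laverage [NormedSpace ℝ F] {f : V → F} {f' : V →L[ℝ] F}
    (hf : ∀ᶠ r : ℝ in 𝓝[>] 0, AEStronglyMeasurable f (μ.restrict (ball y r)))
    (h : Tendsto (fun r : ℝ => ⨍⁻ z in ball y r, ‖f z - f y - f' (z - y)‖ₑ / ‖z - y‖ₑ ∂μ)
      (𝓝[>] 0) (𝓝 0)) : HasApproxFDerivAt μ f f' y := by
  refine hasApproxFDerivAt_iff_isLittleO.2 (Asymptotics.isLittleO_iff.2 fun ε hε => ?_)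
  have hε0 : ENNReal.ofReal ε ≠ 0 := by simpa using hε
  have hlim : Tendsto (fun r : ℝ =>
      (⨍⁻ z in ball y r, ‖f z - f y - f' (z - y)‖ₑ / ‖z - y‖ₑ ∂μ) / ENNReal.ofReal ε)
      (𝓝[>] 0) (𝓝 0) := by
    simpa using ENNReal.Tendsto.div_const h (Or.inr hε0)
  rw [eventually_apNhds_iff]
  refine tendsto_of_tendsto_of_tendsto_of_le_of_le' tendsto_const_nhds hlim
    (.of_forall fun _ => zero_le) ?_
  filter_upwards [hf] with r hr
  have subset_superlevel : {z ∈ ball y r | ¬ ‖f z - f y - f' (z - y)‖ ≤ ε * ‖z - y‖} ⊆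
      {z | ENNReal.ofReal ε ≤ ‖f z - f y - f' (z - y)‖ₑ / ‖z - y‖ₑ} ∩ ball y r := by
    rintro z ⟨hz, hzε⟩
    refine ⟨?_, hz⟩
    have hzy : z ≠ y := by rintro rfl; simp at hzε
    rw [Set.mem_ofPred_eq, ENNReal.le_div_iff_mul_le (Or.inl (by simpa [sub_eq_zero] using hzy))
      (Or.inl enorm_ne_top), ← ofReal_norm, ← ofReal_norm, ← ENNReal.ofReal_mul hε.le]
    exact ENNReal.ofReal_le_ofReal (not_le.1 hzε).le
  have aemeasurable_quotient : AEMeasurable (fun z => ‖f z - f y - f' (z - y)‖ₑ / ‖z - y‖ₑ)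
      (μ.restrict (ball y r)) := by
    have hnum : AEStronglyMeasurable (fun z => f z - f y - f' (z - y)) (μ.restrict (ball y r)) :=
      (hr.sub aestronglyMeasurable_const).sub
        (by fun_prop : Continuous fun z => f' (z - y)).aestronglyMeasurable
    exact hnum.enorm.div (by fun_prop : Continuous fun z : V => ‖z - y‖ₑ).measurable.aemeasurable
  rw [setLAverage_eq, ENNReal.div_right_comm]
  gcongr
  calc μ {z ∈ ball y r | ¬ ‖f z - f y - f' (z - y)‖ ≤ ε * ‖z - y‖}
    _ ≤ μ.restrict (ball y r) {z | ENNReal.ofReal ε ≤ ‖f z - f y - f' (z - y)‖ₑ / ‖z - y‖ₑ} :=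
      (measure_mono subset_superlevel).trans (Measure.le_restrict_apply _ _)
    _ ≤ _ := meas_ge_le_lintegral_div aemeasurable_quotient hε0 ENNReal.ofReal_ne_top

variable [μ.IsAddHaarMeasure]

theorem ae_tendsto_laverage_enorm_sub {g : V → F} (hg : LocallyIntegrable g μ) :
    ∀ᵐ y ∂μ, Tendsto (fun r : ℝ => ⨍⁻ w in ball y r, ‖g w - g y‖ₑ ∂μ) (𝓝[>] 0) (𝓝 0) := by
  filter_upwards [(Besicovitch.vitaliFamily μ).ae_tendsto_lintegral_enorm_sub_div hg] with y hy
  refine (hy.comp (Besicovitch.tendsto_filterAt μ y)).congr' ?_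
  filter_upwards [self_mem_nhdsWithin] with r (hr : 0 < r)
  have ball_ae_eq : (closedBall y r : Set V) =ᵐ[μ] ball y r := by
    rw [← ball_union_sphere]
    exact union_ae_eq_left_of_ae_eq_empty
      (ae_eq_empty.2 (Measure.addHaar_sphere_of_ne_zero μ y hr.ne'))
  rw [← setLAverage_congr ball_ae_eq, setLAverage_eq]
  rfl

theorem laverage_ball_comp_homothety {H : V → ℝ≥0∞} {s : ℝ} (hs : 0 < s) (r : ℝ) :
    ⨍⁻ z in ball y r, H (y + s • (z - y)) ∂μ = ⨍⁻ z in ball y (s * r), H z ∂μ := by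
  set k : V → ℝ≥0∞ := (ball y (s * r)).indicator H
  have hs' : ENNReal.ofReal (s ^ finrank ℝ V) ≠ 0 := by positivity
  have lintegral_k :
      ∫⁻ z, k z ∂μ = ENNReal.ofReal (s ^ finrank ℝ V) * ∫⁻ z, k (y + s • (z - y)) ∂μ := by
    have hmap := (Homeomorph.smulOfNeZero s hs.ne').measurableEmbedding.lintegral_map (μ := μ)
      fun w => k (y + w)
    simp only [Homeomorph.smulOfNeZero_apply, Measure.map_addHaar_smul μ hs.ne',
      lintegral_smul_measure, lintegral_add_left_eq_self k y] at hmap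
    rw [lintegral_sub_right_eq_self (fun w => k (y + s • w)) y, ← hmap, smul_eq_mul, ← mul_assoc,
      ← ENNReal.ofReal_mul (by positivity), abs_of_pos (by positivity),
      mul_inv_cancel₀ (by positivity), ENNReal.ofReal_one, one_mul]
  have comp_eq_indicator (z : V) :
      k (y + s • (z - y)) = (ball y r).indicator (fun z => H (y + s • (z - y))) z := by
    have mem_iff : y + s • (z - y) ∈ ball y (s * r) ↔ z ∈ ball y r := by
      simp [mem_ball_iff_norm, norm_smul, abs_of_pos hs, hs, -mem_ball]
    by_cases hz : z ∈ ball y r <;> simp [k, hz, mem_iff]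
  rw [setLAverage_eq, setLAverage_eq, ← lintegral_indicator measurableSet_ball,
    ← lintegral_indicator measurableSet_ball, ← lintegral_congr comp_eq_indicator, lintegral_k,
    Measure.addHaar_ball_mul_of_pos μ y hs, Measure.addHaar_ball_center,
    ENNReal.mul_div_mul_left _ _ hs' ENNReal.ofReal_ne_top]

theorem laverage_lintegral_segment_le {H : V → ℝ≥0∞} (hH : Measurable H) {C : ℝ≥0∞} {r : ℝ}
    (hr : 0 < r) (h : ∀ t ∈ Set.Ioc 0 r, ⨍⁻ w in ball y t, H w ∂μ ≤ C) :
    ⨍⁻ z in ball y r, (∫⁻ s in Set.Ioc (0 : ℝ) 1, H (y + s • (z - y))) ∂μ ≤ C := by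
  have measurable_uncurry :
      Measurable (Function.uncurry fun (z : V) (s : ℝ) => H (y + s • (z - y))) :=
    hH.comp (by fun_prop)
  rw [setLAverage_eq', lintegral_lintegral_swap measurable_uncurry.aemeasurable]
  simp only [← setLAverage_eq']
  calc ∫⁻ s in Set.Ioc (0 : ℝ) 1, ⨍⁻ z in ball y r, H (y + s • (z - y)) ∂μ
    _ ≤ ∫⁻ _ in Set.Ioc (0 : ℝ) 1, C := by
      refine setLIntegral_mono' measurableSet_Ioc fun s hs => ?_
      rw [laverage_ball_comp_homothety hs.1]
      exact h _ ⟨mul_pos hs.1 hr, mul_le_of_le_one_left hr.le hs.2⟩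
    _ = C := by simp

theorem measure_ball_two_mul (y : V) (r : ℝ) :
    μ (ball y (2 * r)) = 2 ^ finrank ℝ V * μ (ball y r) := by
  rw [Measure.addHaar_ball_mul_of_pos μ y two_pos, ENNReal.ofReal_pow two_pos.le,
    ENNReal.ofReal_ofNat, Measure.addHaar_ball_center μ y]

section Bump

variable (φ : ContDiffBump (0 : V)) {k : V → ℝ≥0∞} {t : ℝ}

theorem normed_sub_eq_zero_of_add_le {w x : V} {s : ℝ} (hw : w ∈ ball y t)
    (hx : x ∉ ball y s) (hts : t + φ.rOut ≤ s) : φ.normed μ (w - x) = 0 := by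
  by_contra hne
  have hwx : w - x ∈ Function.support (φ.normed μ) := hne
  rw [φ.support_normed_eq, mem_ball_zero_iff, ← dist_eq_norm, dist_comm] at hwx
  exact hx (mem_ball.2 (by linarith [dist_triangle x w y, mem_ball.1 hw]))

theorem lintegral_normed_sub_mul_le (hφ : φ.rOut ≤ 2 * φ.rIn) {w : V} (hw : w ∈ ball y φ.rOut) :
    ∫⁻ x, ENNReal.ofReal (φ.normed μ (w - x)) * k x ∂μ ≤
      4 ^ finrank ℝ V * ⨍⁻ x in ball y (2 * φ.rOut), k x ∂μ := by
  set c : ℝ≥0∞ := 2 ^ finrank ℝ V / μ (ball y φ.rOut) with hc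
  have hc_top : c ≠ ⊤ :=
    ENNReal.div_ne_top (by simp) (measure_ball_pos μ y φ.rOut_pos).ne'
  have normed_le (x : V) : ENNReal.ofReal (φ.normed μ x) ≤ c := by
    have measure_pos : 0 < μ.real (closedBall (0 : V) φ.rOut) :=
      ENNReal.toReal_pos (measure_closedBall_pos _ _ φ.rOut_pos).ne' measure_closedBall_lt_top.ne
    refine (ENNReal.ofReal_le_ofReal (φ.normed_le_div_measure_closedBall_rOut μ 2 hφ x)).trans ?_
    rw [ENNReal.ofReal_div_of_pos measure_pos, Measure.real,
      ENNReal.ofReal_toReal measure_closedBall_lt_top.ne, ENNReal.ofReal_pow two_pos.le,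
      ENNReal.ofReal_ofNat, hc, Measure.addHaar_ball_center μ y]
    gcongr
    exact ball_subset_closedBall
  have le_indicator (x : V) : ENNReal.ofReal (φ.normed μ (w - x)) * k x ≤
      (ball y (2 * φ.rOut)).indicator (fun x => c * k x) x := by
    by_cases hx : x ∈ ball y (2 * φ.rOut)
    · rw [Set.indicator_of_mem hx]
      gcongr
      exact normed_le _
    · simp [normed_sub_eq_zero_of_add_le φ hw hx (two_mul _).ge]
  calc ∫⁻ x, ENNReal.ofReal (φ.normed μ (w - x)) * k x ∂μ
    _ ≤ ∫⁻ x in ball y (2 * φ.rOut), c * k x ∂μ := by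
      rw [← lintegral_indicator measurableSet_ball]
      exact lintegral_mono le_indicator
    _ = c * μ (ball y (2 * φ.rOut)) * ⨍⁻ x in ball y (2 * φ.rOut), k x ∂μ := by
      rw [lintegral_const_mul' _ _ hc_top, mul_assoc,
        measure_mul_setLAverage _ measure_ball_lt_top.ne]
    _ = 4 ^ finrank ℝ V * ⨍⁻ x in ball y (2 * φ.rOut), k x ∂μ := by
      rw [measure_ball_two_mul, hc, mul_left_comm,
        ENNReal.div_mul_cancel (measure_ball_pos μ y φ.rOut_pos).ne' measure_ball_lt_top.ne,
        ← mul_pow]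
      norm_num

theorem laverage_lintegral_normed_sub_mul_le (hk : AEMeasurable k μ) (ht : φ.rOut ≤ t) :
    ⨍⁻ w in ball y t, (∫⁻ x, ENNReal.ofReal (φ.normed μ (w - x)) * k x ∂μ) ∂μ ≤
      2 ^ finrank ℝ V * ⨍⁻ x in ball y (2 * t), k x ∂μ := by
  have measurable_normed := (φ.continuous_normed (μ := μ)).measurable
  have lintegral_normed (x : V) : ∫⁻ w, ENNReal.ofReal (φ.normed μ (w - x)) ∂μ = 1 := by
    rw [lintegral_sub_right_eq_self (fun w => ENNReal.ofReal (φ.normed μ w)) x,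
      ← ofReal_integral_eq_lintegral_ofReal φ.integrable_normed (.of_forall φ.nonneg_normed),
      φ.integral_normed, ENNReal.ofReal_one]
  have le_indicator (x : V) : ∫⁻ w in ball y t, ENNReal.ofReal (φ.normed μ (w - x)) * k x ∂μ ≤
      (ball y (2 * t)).indicator k x := by
    by_cases hx : x ∈ ball y (2 * t)
    · rw [Set.indicator_of_mem hx, lintegral_mul_const _ (by fun_prop)]
      exact mul_le_of_le_one_left' ((setLIntegral_le_lintegral _ _).trans (lintegral_normed x).le)
    · rw [setLIntegral_congr_fun measurableSet_ball fun w hw => by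
        rw [normed_sub_eq_zero_of_add_le φ hw hx (by linarith), ENNReal.ofReal_zero, zero_mul]]
      simp
  have lintegral_le : ∫⁻ w in ball y t, ∫⁻ x, ENNReal.ofReal (φ.normed μ (w - x)) * k x ∂μ ∂μ ≤
      ∫⁻ x in ball y (2 * t), k x ∂μ := by
    have aemeasurable_mul : AEMeasurable
        (Function.uncurry fun w x => ENNReal.ofReal (φ.normed μ (w - x)) * k x)
        ((μ.restrict (ball y t)).prod μ) :=
      Measurable.aemeasurable (by fun_prop) |>.mul hk.comp_snd
    rw [lintegral_lintegral_swap aemeasurable_mul, ← lintegral_indicator measurableSet_ball]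
    exact lintegral_mono le_indicator
  rw [setLAverage_eq]
  refine ENNReal.div_le_of_le_mul ?_
  rwa [mul_right_comm, ← measure_ball_two_mul y, measure_mul_setLAverage _
    measure_ball_lt_top.ne]

theorem laverage_lintegral_normed_sub_mul_le_of_forall (hφ : φ.rOut ≤ 2 * φ.rIn)
    (hk : AEMeasurable k μ) {δ : ℝ≥0∞} {r : ℝ} (hφr : φ.rOut ≤ r)
    (h : ∀ s ∈ Set.Ioc 0 (2 * r), ⨍⁻ x in ball y s, k x ∂μ ≤ δ) (ht : t ∈ Set.Ioc 0 r) :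
    ⨍⁻ w in ball y t, (∫⁻ x, ENNReal.ofReal (φ.normed μ (w - x)) * k x ∂μ) ∂μ ≤
      4 ^ finrank ℝ V * δ := by
  rcases le_total t φ.rOut with htφ | htφ
  · rw [setLAverage_eq]
    refine ENNReal.div_le_of_le_mul ?_
    rw [← setLIntegral_const]
    refine setLIntegral_mono' measurableSet_ball fun w hw =>
      (lintegral_normed_sub_mul_le φ hφ (ball_subset_ball htφ hw)).trans ?_
    gcongr
    exact h _ ⟨mul_pos two_pos φ.rOut_pos, by gcongr⟩
  · refine (laverage_lintegral_normed_sub_mul_le φ hk htφ).trans ?_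
    gcongr
    · norm_num
    · exact h _ ⟨mul_pos two_pos ht.1, by gcongr; exact ht.2⟩

end Bump

end BallAverage

section WeakGradient

open Metric Module ContinuousLinearMap
open scoped Convolution

variable {V F : Type*} [NormedAddCommGroup V] [NormedSpace ℝ V] [NormedAddCommGroup F]
  [NormedSpace ℝ F] {Ω : Set V} {f f₁ : V → F} {g g₁ : V → V →L[ℝ] F}

theorem fderiv_eq_zero_of_notMem_tsupport {φ : V → F} {y : V} (hy : y ∉ tsupport φ) :
    fderiv ℝ φ y = 0 :=
  image_eq_zero_of_notMem_tsupport fun h => hy (tsupport_fderiv_subset ℝ h)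

theorem enorm_sub_le_lintegral_segment [CompleteSpace F] (hg : Continuous g) {y z : V}
    (hf : ∀ s ∈ Set.Icc (0 : ℝ) 1, HasFDerivAt f (g (y + s • (z - y))) (y + s • (z - y))) :
    ‖f z - f y‖ₑ ≤ ‖z - y‖ₑ * ∫⁻ s in Set.Ioc (0 : ℝ) 1, ‖g (y + s • (z - y))‖ₑ := by
  have hasDerivAt_segment : ∀ s ∈ Set.uIcc (0 : ℝ) 1,
      HasDerivAt (fun s : ℝ => f (y + s • (z - y))) (g (y + s • (z - y)) (z - y)) s := by
    intro s hs
    rw [Set.uIcc_of_le zero_le_one] at hs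
    have hline : HasDerivAt (fun s : ℝ => y + s • (z - y)) (z - y) s := by
      simpa using ((hasDerivAt_id s).smul_const (z - y)).const_add y
    exact (hf s hs).comp_hasDerivAt s hline
  have integral_eq : ∫ s in Set.Ioc (0 : ℝ) 1, g (y + s • (z - y)) (z - y) = f z - f y := by
    rw [← intervalIntegral.integral_of_le zero_le_one,
      intervalIntegral.integral_eq_sub_of_hasDerivAt hasDerivAt_segment
        (Continuous.intervalIntegrable (by fun_prop) 0 1)]
    simp
  calc ‖f z - f y‖ₑ
    _ ≤ ∫⁻ s in Set.Ioc (0 : ℝ) 1, ‖g (y + s • (z - y)) (z - y)‖ₑ :=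
      integral_eq ▸ enorm_integral_le_lintegral_enorm _
    _ ≤ ∫⁻ s in Set.Ioc (0 : ℝ) 1, ‖z - y‖ₑ * ‖g (y + s • (z - y))‖ₑ :=
      lintegral_mono fun s => (le_opENorm _ _).trans_eq (mul_comm _ _)
    _ = ‖z - y‖ₑ * ∫⁻ s in Set.Ioc (0 : ℝ) 1, ‖g (y + s • (z - y))‖ₑ :=
      lintegral_const_mul' _ _ enorm_ne_top

variable [MeasurableSpace V] {μ : Measure V}

/-- `g` is a weak gradient of `f` in the open set `Ω`, with respect to the measure `μ`. The
integrals extend over the whole space, where the test function vanishes outside `Ω`. -/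
def IsWeakGradOn (μ : Measure V) (Ω : Set V) (f : V → F) (g : V → V →L[ℝ] F) : Prop :=
  ∀ φ : V → ℝ, ContDiff ℝ ∞ φ → HasCompactSupport φ → tsupport φ ⊆ Ω → ∀ v : V,
    ∫ y, fderiv ℝ φ y v • f y ∂μ = -∫ y, φ y • g y v ∂μ

theorem isWeakGradOn_iff_setIntegral : IsWeakGradOn μ Ω f g ↔
    ∀ φ : V → ℝ, ContDiff ℝ ∞ φ → HasCompactSupport φ → tsupport φ ⊆ Ω → ∀ v : V,
      ∫ y in Ω, fderiv ℝ φ y v • f y ∂μ = -∫ y in Ω, φ y • g y v ∂μ := by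
  refine forall_congr' fun φ => forall₃_congr fun _ _ hφ => forall_congr' fun v => ?_
  rw [setIntegral_eq_integral_of_forall_compl_eq_zero fun y hy => ?_,
    setIntegral_eq_integral_of_forall_compl_eq_zero fun y hy => ?_]
  · rw [image_eq_zero_of_notMem_tsupport fun h => hy (hφ h), zero_smul]
  · simp [fderiv_eq_zero_of_notMem_tsupport fun h => hy (hφ h)]

theorem IsWeakGradOn.congr (h : IsWeakGradOn μ Ω f g) (hf : Set.EqOn f f₁ Ω)
    (hg : Set.EqOn g g₁ Ω) : IsWeakGradOn μ Ω f₁ g₁ := by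
  intro φ hφ hφc hφΩ v
  have smul_f (y : V) : fderiv ℝ φ y v • f₁ y = fderiv ℝ φ y v • f y := by
    by_cases hy : y ∈ tsupport φ
    · rw [hf (hφΩ hy)]
    · simp [fderiv_eq_zero_of_notMem_tsupport hy]
  have smul_g (y : V) : φ y • g₁ y v = φ y • g y v := by
    by_cases hy : y ∈ tsupport φ
    · rw [hg (hφΩ hy)]
    · simp [image_eq_zero_of_notMem_tsupport hy]
  simpa only [smul_f, smul_g] using h φ hφ hφc hφΩ v

variable [BorelSpace V] [FiniteDimensional ℝ V] [μ.IsAddHaarMeasure] {φ : ContDiffBump (0 : V)}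

/-- The mollification of `f` by the normalized bump function `φ`. -/
noncomputable abbrev mollify (μ : Measure V) (φ : ContDiffBump (0 : V)) (f : V → F) : V → F :=
  φ.normed μ ⋆[lsmul ℝ ℝ, μ] f

theorem continuous_mollify (hf : LocallyIntegrable f μ) : Continuous (mollify μ φ f) :=
  φ.hasCompactSupport_normed.continuous_convolution_left _ φ.continuous_normed hf

theorem integrable_normed_sub_smul (hf : LocallyIntegrable f μ) (x : V) :
    Integrable (fun t => φ.normed μ (x - t) • f t) μ := by
  simpa using (φ.hasCompactSupport_normed.convolutionExists_left (lsmul ℝ ℝ)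
    φ.continuous_normed hf x).integrable_swap

theorem mollify_apply (x : V) : mollify μ φ f x = ∫ t, φ.normed μ (x - t) • f t ∂μ :=
  convolution_eq_swap ..

theorem tsupport_normed_sub_subset (x : V) :
    tsupport (fun t => φ.normed μ (x - t)) ⊆ closedBall x φ.rOut := by
  refine closure_minimal (fun t ht => ?_) isClosed_closedBall
  have hxt : x - t ∈ Function.support (φ.normed μ) := ht
  rw [φ.support_normed_eq, mem_ball_zero_iff] at hxt
  exact mem_closedBall_iff_norm'.2 hxt.le

theorem hasFDerivAt_mollify (hf : LocallyIntegrable f μ) (hg : LocallyIntegrable g μ)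
    (hfg : IsWeakGradOn μ Ω f g) {x : V} (hx : closedBall x φ.rOut ⊆ Ω) :
    HasFDerivAt (mollify μ φ f) (mollify μ φ g x) x := by
  have contDiff_normed : ContDiff ℝ ∞ (φ.normed μ) := φ.contDiff_normed
  have hderiv := φ.hasCompactSupport_normed (μ := μ).hasFDerivAt_convolution_left (lsmul ℝ ℝ)
    (φ.contDiff_normed (n := 1)) hf x
  convert hderiv using 1
  refine ContinuousLinearMap.ext fun v => ?_
  have fderiv_sub (t : V) :
      fderiv ℝ (fun t => φ.normed μ (x - t)) t v = -fderiv ℝ (φ.normed μ) (x - t) v := by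
    have hsub : HasFDerivAt (fun t => x - t) (-ContinuousLinearMap.id ℝ V) t :=
      (hasFDerivAt_id t).const_sub x
    have hcomp := ((contDiff_normed.differentiable (by simp) _).hasFDerivAt.comp t hsub).fderiv
    simpa [Function.comp_def] using congr($hcomp v)
  have weak := hfg (fun t => φ.normed μ (x - t)) (contDiff_normed.comp (by fun_prop))
    ((isCompact_closedBall x φ.rOut).of_isClosed_subset (isClosed_tsupport _)
      (tsupport_normed_sub_subset x)) ((tsupport_normed_sub_subset x).trans hx) v
  simp only [fderiv_sub, neg_smul, integral_neg, neg_inj] at weak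
  have hexists := ((φ.hasCompactSupport_normed (μ := μ)).fderiv ℝ).convolutionExists_left
    ((lsmul ℝ ℝ).precompL V) (contDiff_normed.continuous_fderiv (by simp)) hf x
  rw [mollify_apply, convolution_eq_swap,
    ContinuousLinearMap.integral_apply (integrable_normed_sub_smul hg x),
    ContinuousLinearMap.integral_apply hexists.integrable_swap]
  simpa [precompL_apply] using weak.symm

theorem enorm_mollify_sub_le [CompleteSpace F] (hf : LocallyIntegrable f μ) (A : F) (w : V) :
    ‖mollify μ φ f w - A‖ₑ ≤ ∫⁻ x, ENNReal.ofReal (φ.normed μ (w - x)) * ‖f x - A‖ₑ ∂μ := by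
  have mollify_sub_const :
      mollify μ φ f w - A = ∫ x, φ.normed μ (w - x) • (f x - A) ∂μ := by
    simp only [smul_sub]
    rw [integral_sub (integrable_normed_sub_smul hf w)
      ((φ.integrable_normed.comp_sub_left w).smul_const A), integral_smul_const,
      integral_sub_left_eq_self (fun x => φ.normed μ x), φ.integral_normed, one_smul,
      mollify_apply]
  rw [mollify_sub_const]
  refine (enorm_integral_le_lintegral_enorm _).trans (lintegral_mono fun x => ?_)
  rw [enorm_smul, Real.enorm_of_nonneg (φ.nonneg_normed _)]

variable [CompleteSpace F] {y : V} {r : ℝ} {A : V →L[ℝ] F} {δ : ℝ≥0∞}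

theorem laverage_mollify_expansion_le (hf : LocallyIntegrable f μ) (hg : LocallyIntegrable g μ)
    (hfg : IsWeakGradOn μ Ω f g) (hφ : φ.rOut ≤ 2 * φ.rIn) (hφr : φ.rOut ≤ r)
    (hyr : ball y (2 * r) ⊆ Ω)
    (h : ∀ s ∈ Set.Ioc 0 (2 * r), ⨍⁻ w in ball y s, ‖g w - A‖ₑ ∂μ ≤ δ) :
    ⨍⁻ z in ball y r, ‖mollify μ φ f z - mollify μ φ f y - A (z - y)‖ₑ / ‖z - y‖ₑ ∂μ ≤
      4 ^ finrank ℝ V * δ := by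
  have hr : 0 < r := φ.rOut_pos.trans_le hφr
  have continuous_deriv : Continuous fun w => mollify μ φ g w - A :=
    (continuous_mollify hg).sub continuous_const
  have hasFDerivAt_sub : ∀ w ∈ ball y r,
      HasFDerivAt (fun w => mollify μ φ f w - A w) (mollify μ φ g w - A) w := by
    intro w hw
    refine (hasFDerivAt_mollify hf hg hfg (Set.Subset.trans (fun x hx => ?_) hyr)).sub
      A.hasFDerivAt
    rw [mem_ball] at hw ⊢
    linarith [dist_triangle x w y, mem_closedBall.1 hx]
  have segment_bound : ∀ z ∈ ball y r,
      ‖mollify μ φ f z - mollify μ φ f y - A (z - y)‖ₑ / ‖z - y‖ₑ ≤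
        ∫⁻ s in Set.Ioc (0 : ℝ) 1, ‖mollify μ φ g (y + s • (z - y)) - A‖ₑ := by
    intro z hz
    refine ENNReal.div_le_of_le_mul' ?_
    convert enorm_sub_le_lintegral_segment continuous_deriv fun s hs => hasFDerivAt_sub _ <|
      (convex_ball y r).add_smul_sub_mem (mem_ball_self hr) hz hs using 2
    rw [map_sub]
    abel
  calc ⨍⁻ z in ball y r, ‖mollify μ φ f z - mollify μ φ f y - A (z - y)‖ₑ / ‖z - y‖ₑ ∂μ
    _ ≤ ⨍⁻ z in ball y r,
        (∫⁻ s in Set.Ioc (0 : ℝ) 1, ‖mollify μ φ g (y + s • (z - y)) - A‖ₑ) ∂μ := by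
      rw [setLAverage_eq, setLAverage_eq]
      gcongr ?_ / _
      exact setLIntegral_mono' measurableSet_ball segment_bound
    _ ≤ 4 ^ finrank ℝ V * δ := by
      refine laverage_lintegral_segment_le (H := fun w => ‖mollify μ φ g w - A‖ₑ)
        continuous_deriv.enorm.measurable hr fun t ht => ?_
      refine (laverage_mono_ae (.of_forall fun w => enorm_mollify_sub_le hg A w)).trans ?_
      exact laverage_lintegral_normed_sub_mul_le_of_forall φ hφ
        (hg.aestronglyMeasurable.sub aestronglyMeasurable_const).enorm hφr h ht

theorem laverage_expansion_le {ι : Type*} {l : Filter ι} [l.NeBot] [l.IsCountablyGenerated]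
    (hf : LocallyIntegrable f μ) (hg : LocallyIntegrable g μ) (hfg : IsWeakGradOn μ Ω f g)
    {φ : ι → ContDiffBump (0 : V)} (hφ : ∀ k, (φ k).rOut ≤ 2 * (φ k).rIn)
    (hφ0 : Tendsto (fun k => (φ k).rOut) l (𝓝 0))
    (hφf : ∀ᵐ z ∂μ, Tendsto (fun k => mollify μ (φ k) f z) l (𝓝 (f z)))
    (hφy : Tendsto (fun k => mollify μ (φ k) f y) l (𝓝 (f y)))
    (hr : 0 < r) (hyr : ball y (2 * r) ⊆ Ω)
    (h : ∀ s ∈ Set.Ioc 0 (2 * r), ⨍⁻ w in ball y s, ‖g w - A‖ₑ ∂μ ≤ δ) :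
    ⨍⁻ z in ball y r, ‖f z - f y - A (z - y)‖ₑ / ‖z - y‖ₑ ∂μ ≤ 4 ^ finrank ℝ V * δ := by
  set T : ι → V → ℝ≥0∞ := fun k z =>
    ‖mollify μ (φ k) f z - mollify μ (φ k) f y - A (z - y)‖ₑ / ‖z - y‖ₑ with hT
  have measurable_T (k : ι) : Measurable (T k) := by
    have := continuous_mollify (φ := φ k) hf
    exact (Continuous.measurable (by fun_prop)).div (Continuous.measurable (by fun_prop))
  have eq_liminf : ∀ᵐ z ∂μ, ‖f z - f y - A (z - y)‖ₑ / ‖z - y‖ₑ = liminf (fun k => T k z) l := by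
    filter_upwards [hφf] with z hz
    refine (Tendsto.liminf_eq ?_).symm
    obtain rfl | hzy := eq_or_ne z y
    · simp [hT]
    · refine ENNReal.Tendsto.div_const ?_ (Or.inr (by simpa [sub_eq_zero] using hzy))
      exact ((hz.sub hφy).sub_const _).enorm
  calc ⨍⁻ z in ball y r, ‖f z - f y - A (z - y)‖ₑ / ‖z - y‖ₑ ∂μ
    _ = ⨍⁻ z in ball y r, liminf (fun k => T k z) l ∂μ :=
      laverage_congr (ae_restrict_of_ae eq_liminf)
    _ ≤ liminf (fun k => ⨍⁻ z in ball y r, T k z ∂μ) l := 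
      lintegral_liminf_le' fun k => (measurable_T k).aemeasurable
    _ ≤ 4 ^ finrank ℝ V * δ := by
      refine liminf_le_of_frequently_le' (Eventually.frequently ?_)
      filter_upwards [hφ0.eventually (gt_mem_nhds hr)] with k hk
      exact laverage_mollify_expansion_le hf hg hfg (hφ k) hk.le hyr h

theorem IsWeakGradOn.ae_hasApproxFDerivAt (hΩ : IsOpen Ω) (hf : LocallyIntegrable f μ)
    (hg : LocallyIntegrable g μ) (hfg : IsWeakGradOn μ Ω f g) :
    ∀ᵐ y ∂μ, y ∈ Ω → HasApproxFDerivAt μ f (g y) y := by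
  obtain ⟨φ, hφ, hφ0⟩ : ∃ φ : ℕ → ContDiffBump (0 : V), (∀ k, (φ k).rOut ≤ 2 * (φ k).rIn) ∧
      Tendsto (fun k => (φ k).rOut) atTop (𝓝 0) := by
    refine ⟨fun k => ⟨1 / (k + 1), 2 * (1 / (k + 1)), by positivity,
      lt_two_mul_self (by positivity)⟩, fun k => le_rfl, ?_⟩
    simpa only [mul_zero] using (tendsto_one_div_add_atTop_nhds_zero_nat (𝕜 := ℝ)).const_mul 2
  have hφf := ContDiffBump.ae_convolution_tendsto_right_of_locallyIntegrable hφ0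
    (.of_forall hφ) hf
  filter_upwards [hφf, ae_tendsto_laverage_enorm_sub hg] with y hφy lebesgue hyΩ
  refine hasApproxFDerivAt_of_tendsto_laverage
    (.of_forall fun _ => hf.aestronglyMeasurable.restrict)
    (ENNReal.tendsto_nhds_zero.2 fun η hη => ?_)
  have hδ : 0 < η / 4 ^ finrank ℝ V := ENNReal.div_pos hη.ne' (by simp)
  obtain ⟨r₀, hr₀, average_le⟩ :=
    mem_nhdsGT_iff_exists_Ioo_subset.1 (ENNReal.tendsto_nhds_zero.1 lebesgue _ hδ)
  obtain ⟨r₁, hr₁, ball_subset⟩ := isOpen_iff.1 hΩ y hyΩ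
  filter_upwards [Ioo_mem_nhdsGT (half_pos (lt_min hr₀ hr₁))] with r hr
  have hr2 : 2 * r < min r₀ r₁ := by linarith [hr.2]
  refine (laverage_expansion_le hf hg hfg hφ hφ0 hφf hφy hr.1
    ((ball_subset_ball (hr2.le.trans (min_le_right _ _))).trans ball_subset)
    fun s hs => average_le ⟨hs.1, hs.2.trans_lt (hr2.trans_le (min_le_left _ _))⟩).trans ?_
  exact ENNReal.mul_div_le

end WeakGradient

section EnergyForm

open Module ContinuousLinearMap

section Determinant

variable {V : Type*} [NormedAddCommGroup V] [NormedSpace ℝ V]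

theorem det_eq_det_toMatrix {ι : Type*} [Fintype ι] [DecidableEq ι] (b : Basis ι ℝ V)
    (A : V →L[ℝ] V) : A.det = (LinearMap.toMatrix b b A).det :=
  (LinearMap.det_toMatrix b A).symm

variable [FiniteDimensional ℝ V]

/-- The trace as a continuous linear form on the endomorphisms of a finite-dimensional space. -/
noncomputable def traceCLM (V : Type*) [NormedAddCommGroup V] [NormedSpace ℝ V]
    [FiniteDimensional ℝ V] : (V →L[ℝ] V) →L[ℝ] ℝ :=
  LinearMap.toContinuousLinearMap (LinearMap.trace ℝ V ∘ₗ ContinuousLinearMap.coeLM ℝ)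

theorem traceCLM_apply (A : V →L[ℝ] V) : traceCLM V A = LinearMap.trace ℝ V A := rfl

theorem contDiff_det : ContDiff ℝ ∞ fun A : V →L[ℝ] V => A.det := by
  have entry (i j : Fin (finrank ℝ V)) : ContDiff ℝ ∞ fun A : V →L[ℝ] V =>
      LinearMap.toMatrix (finBasis ℝ V) (finBasis ℝ V) A i j := by
    simp only [LinearMap.toMatrix_apply]
    exact (((finBasis ℝ V).coord i).toContinuousLinearMap ∘L
      ContinuousLinearMap.apply ℝ V (finBasis ℝ V j)).contDiff
  simp only [det_eq_det_toMatrix (finBasis ℝ V), Matrix.det_apply]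
  exact ContDiff.sum fun σ _ => (contDiff_prod fun i _ => entry (σ i) i).const_smul _

theorem hasDerivAt_det_one_add_smul (A : V →L[ℝ] V) :
    HasDerivAt (fun t : ℝ => (1 + t • A).det) (traceCLM V A) 0 := by
  set M := LinearMap.toMatrix (finBasis ℝ V) (finBasis ℝ V) A
  have det_eq_eval (t : ℝ) : (1 + t • A).det =
      (Matrix.det (1 + (Polynomial.X : Polynomial ℝ) • M.map Polynomial.C)).eval t := by
    have toMatrix_eq : LinearMap.toMatrix (finBasis ℝ V) (finBasis ℝ V) ↑(1 + t • A) =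
        1 + t • M := by
      simp [M, LinearMap.toMatrix_one, ContinuousLinearMap.toLinearMap_one]
    rw [det_eq_det_toMatrix (finBasis ℝ V), toMatrix_eq, eval_det]
    simp [← Matrix.smul_eq_mul_diagonal]
  rw [traceCLM_apply, LinearMap.trace_eq_matrix_trace ℝ (finBasis ℝ V),
    ← Matrix.derivative_det_one_add_X_smul M]
  simpa only [det_eq_eval] using Polynomial.hasDerivAt _ 0

theorem hasFDerivAt_det_one :
    HasFDerivAt (fun A : V →L[ℝ] V => A.det) (traceCLM V) 1 := by
  have hdiff : DifferentiableAt ℝ (fun A : V →L[ℝ] V => A.det) 1 :=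
    contDiff_det.differentiable (by simp) 1
  convert hdiff.hasFDerivAt
  refine ContinuousLinearMap.ext fun A => ?_
  have hline : HasDerivAt (fun t : ℝ => 1 + t • A) A 0 := by
    simpa using ((hasDerivAt_id (0 : ℝ)).smul_const A).const_add 1
  have hdiff' := hdiff.hasFDerivAt
  rw [show (1 : V →L[ℝ] V) = 1 + (0 : ℝ) • A by simp] at hdiff'
  simpa using (hasDerivAt_det_one_add_smul A).unique
    (HasFDerivAt.comp_hasDerivAt (l := fun A : V →L[ℝ] V => A.det) 0 hdiff' hline)

end Determinant

variable {V F : Type*} [NormedAddCommGroup V] [InnerProductSpace ℝ V] [FiniteDimensional ℝ V]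
  [NormedAddCommGroup F] [InnerProductSpace ℝ F] [CompleteSpace F]
  {ι : Type*} [Fintype ι] (b : OrthonormalBasis ι ℝ V)

/-- The quadratic form `∑ⱼ ⟪G eⱼ, G (B eⱼ)⟫` of the gradient `G` with coefficients `B`; the energy
density is the case `B = 1`. It is linear in `B`, and a linear change of variables only changes
`B`. -/
noncomputable def energyForm (B : V →L[ℝ] V) (G : V →L[ℝ] F) : ℝ :=
  traceCLM V (B ∘L adjoint G ∘L G)

theorem energyForm_eq_sum (B : V →L[ℝ] V) (G : V →L[ℝ] F) :
    energyForm B G = ∑ j, inner ℝ (G (b j)) (G (B (b j))) := by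
  have trace_comm : energyForm B G = LinearMap.trace ℝ V (adjoint G ∘L G ∘L B : V →L[ℝ] V) :=
    LinearMap.trace_mul_comm ℝ (B : V →ₗ[ℝ] V) (adjoint G ∘L G : V →L[ℝ] V)
  rw [trace_comm, LinearMap.trace_eq_sum_inner _ b]
  simp [adjoint_inner_right]

theorem energyForm_one_eq_sum (G : V →L[ℝ] F) : energyForm 1 G = ∑ j, ‖G (b j)‖ ^ 2 := by
  simp [energyForm_eq_sum b]

theorem energyForm_one_nonneg (G : V →L[ℝ] F) : 0 ≤ energyForm 1 G := by
  rw [energyForm_one_eq_sum (stdOrthonormalBasis ℝ V)]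
  positivity

theorem energyForm_sub (B C : V →L[ℝ] V) (G : V →L[ℝ] F) :
    energyForm (B - C) G = energyForm B G - energyForm C G := by
  simp [energyForm, sub_comp]

theorem energyForm_smul (c : ℝ) (B : V →L[ℝ] V) (G : V →L[ℝ] F) :
    energyForm (c • B) G = c * energyForm B G := by
  simp [energyForm]

theorem energyForm_comp (B P : V →L[ℝ] V) (G : V →L[ℝ] F) :
    energyForm B (G ∘L P) = energyForm (P ∘L B ∘L adjoint P) G := by
  rw [energyForm, adjoint_comp]
  exact LinearMap.trace_mul_comm ℝ ((B ∘L adjoint P ∘L adjoint G ∘L G : V →L[ℝ] V) : V →ₗ[ℝ] V)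
    (P : V →ₗ[ℝ] V)

theorem abs_energyForm_le (B : V →L[ℝ] V) (G : V →L[ℝ] F) :
    |energyForm B G| ≤ ‖traceCLM V‖ * ‖B‖ * ‖G‖ ^ 2 := by
  calc |energyForm B G|
    _ ≤ ‖traceCLM V‖ * ‖B ∘L adjoint G ∘L G‖ :=
      (traceCLM V).le_opNorm (B ∘L adjoint G ∘L G)
    _ ≤ ‖traceCLM V‖ * (‖B‖ * ‖adjoint G ∘L G‖) := by
      gcongr
      exact opNorm_comp_le _ _
    _ = ‖traceCLM V‖ * ‖B‖ * ‖G‖ ^ 2 := by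
      rw [norm_adjoint_comp_self]
      ring

theorem continuous_energyForm :
    Continuous fun p : (V →L[ℝ] V) × (V →L[ℝ] F) => energyForm p.1 p.2 := by
  unfold energyForm
  fun_prop

/-- The coefficients `|det P| (P* P)⁻¹` of the energy density after the linear change of variables
`P`. -/
noncomputable def pullbackCoeff (P : V →L[ℝ] V) : V →L[ℝ] V :=
  |P.det| • (Ring.inverse P ∘L adjoint (Ring.inverse P))

theorem abs_det_mul_energyForm_comp_inverse (P : V →L[ℝ] V) (G : V →L[ℝ] F) :
    |P.det| * energyForm 1 (G ∘L Ring.inverse P) = energyForm (pullbackCoeff P) G := by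
  rw [energyForm_comp, pullbackCoeff, energyForm_smul]
  rfl

theorem pullbackCoeff_one : pullbackCoeff (1 : V →L[ℝ] V) = 1 := by
  have adjoint_one : adjoint (1 : V →L[ℝ] V) = 1 := star_one _
  have det_one : (1 : V →L[ℝ] V).det = 1 := LinearMap.det_id
  rw [pullbackCoeff, det_one, Ring.inverse_one, adjoint_one, abs_one, one_smul, one_def, comp_id]

/-- The adjoint as a real-linear operator on the endomorphisms. -/
noncomputable def adjointCLM (V : Type*) [NormedAddCommGroup V] [InnerProductSpace ℝ V]
    [FiniteDimensional ℝ V] : (V →L[ℝ] V) →L[ℝ] (V →L[ℝ] V) :=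
  LinearMap.mkContinuous
    { toFun := adjoint
      map_add' := map_add adjoint
      map_smul' := map_smulₛₗ adjoint } 1 fun A => by simp

theorem adjointCLM_apply (A : V →L[ℝ] V) : adjointCLM V A = adjoint A := rfl

/-- The derivative `A ↦ tr A • 1 - A - A*` of `pullbackCoeff` at the identity. -/
noncomputable def pullbackCoeffDeriv (V : Type*) [NormedAddCommGroup V] [InnerProductSpace ℝ V]
    [FiniteDimensional ℝ V] : (V →L[ℝ] V) →L[ℝ] (V →L[ℝ] V) :=
  (traceCLM V).smulRight (1 : V →L[ℝ] V) - ContinuousLinearMap.id ℝ (V →L[ℝ] V) - adjointCLM V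

theorem pullbackCoeffDeriv_apply (A : V →L[ℝ] V) :
    pullbackCoeffDeriv V A = traceCLM V A • 1 - A - adjoint A := rfl

theorem hasFDerivAt_abs_det_one :
    HasFDerivAt (fun P : V →L[ℝ] V => |P.det|) (traceCLM V) 1 := by
  refine hasFDerivAt_det_one.congr_of_eventuallyEq ?_
  have det_pos : ∀ᶠ P : V →L[ℝ] V in 𝓝 1, 0 < P.det :=
    contDiff_det.continuous.continuousAt.eventually_mem
      (isOpen_Ioi.mem_nhds (by simp [ContinuousLinearMap.det]))
  filter_upwards [det_pos] with P hP using abs_of_pos hP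

theorem hasFDerivAt_pullbackCoeff_one :
    HasFDerivAt pullbackCoeff (pullbackCoeffDeriv V) 1 := by
  have hinv : HasFDerivAt Ring.inverse (-ContinuousLinearMap.id ℝ (V →L[ℝ] V)) 1 :=
    (hasFDerivAt_ringInverse (𝕜 := ℝ) (1 : (V →L[ℝ] V)ˣ)).congr_fderiv (by ext; simp)
  have hadj : HasFDerivAt (fun P : V →L[ℝ] V => adjoint (Ring.inverse P)) (-adjointCLM V) 1 :=
    ((adjointCLM V).hasFDerivAt.comp 1 hinv).congr_fderiv (by ext; simp)
  refine (hasFDerivAt_abs_det_one.smul (hinv.clm_comp hadj)).congr_fderiv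
    (ContinuousLinearMap.ext fun A => ?_)
  have adjoint_one : adjoint (1 : V →L[ℝ] V) = 1 := star_one _
  have one_comp (B : V →L[ℝ] V) : (1 : V →L[ℝ] V) ∘L B = B := one_mul B
  have comp_one (B : V →L[ℝ] V) : B ∘L (1 : V →L[ℝ] V) = B := mul_one B
  simp only [ContinuousLinearMap.det, toLinearMap_one, map_one, abs_one, Ring.inverse_one, comp_neg,
    adjoint_one, comp_id, smul_add, smul_neg, one_smul, one_comp, comp_one, add_apply, neg_apply,
    comp_apply, adjointCLM_apply, compL_apply, flip_apply, smulRight_apply,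
    pullbackCoeffDeriv_apply]
  abel

end EnergyForm

section DomainChange

open Module ContinuousLinearMap
open scoped Manifold

variable {V F : Type*} [NormedAddCommGroup V] [NormedSpace ℝ V] [NormedAddCommGroup F]
  [NormedSpace ℝ F] {Ω : Set V}

/-- The map `T` is the identity outside some compact subset of `Ω`. -/
def IsSupportedIn (T : V → V) (Ω : Set V) : Prop :=
  ∃ K ⊆ Ω, IsCompact K ∧ ∀ y ∉ K, T y = y

theorem IsSupportedIn.exists_forall_fderiv_le {T : V → V} (hT : IsSupportedIn T Ω)
    (hTd : ContDiff ℝ ∞ T) {Φ : (V →L[ℝ] V) → ℝ} (hΦ : Continuous Φ) :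
    ∃ C, ∀ y, Φ (fderiv ℝ T y) ≤ C := by
  obtain ⟨K, -, hK, hTK⟩ := hT
  obtain ⟨C, hC⟩ := hK.bddAbove_image
    (hΦ.comp (hTd.continuous_fderiv (by simp))).continuousOn
  refine ⟨max C (Φ (ContinuousLinearMap.id ℝ V)), fun y => ?_⟩
  by_cases hy : y ∈ K
  · exact (hC ⟨y, hy, rfl⟩).trans (le_max_left _ _)
  · have eventually_id : T =ᶠ[𝓝 y] id := by
      filter_upwards [hK.isClosed.isOpen_compl.mem_nhds hy] with z hz using hTK z hz
    rw [eventually_id.fderiv_eq, fderiv_id]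
    exact le_max_right _ _

theorem IsSupportedIn.symm {T : V ≃ₘ[ℝ] V} (hT : IsSupportedIn T Ω) :
    IsSupportedIn T.symm Ω := by
  obtain ⟨K, hKΩ, hK, hTK⟩ := hT
  refine ⟨K, hKΩ, hK, fun z hz => ?_⟩
  nth_rw 1 [← hTK z hz]
  exact T.symm_apply_apply z

theorem IsSupportedIn.preimage_symm_eq {T : V ≃ₘ[ℝ] V} (hT : IsSupportedIn T Ω) :
    T.symm ⁻¹' Ω = Ω := by
  have subset_preimage {S : V ≃ₘ[ℝ] V} (hS : IsSupportedIn S Ω) : S ⁻¹' Ω ⊆ Ω := by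
    obtain ⟨K, hKΩ, -, hSK⟩ := hS
    intro y hy
    by_cases hyK : y ∈ K
    · exact hKΩ hyK
    · rwa [Set.mem_preimage, hSK y hyK] at hy
  refine (subset_preimage hT.symm).antisymm fun z hz => subset_preimage hT ?_
  rwa [Set.mem_preimage, T.apply_symm_apply]

section Diffeomorph

variable (T : V ≃ₘ[ℝ] V)

theorem hasFDerivAt_diffeomorph (y : V) : HasFDerivAt T (fderiv ℝ T y) y :=
  (T.contDiff.differentiable (by simp) y).hasFDerivAt

theorem fderiv_symm_mul_fderiv (y : V) : fderiv ℝ T.symm (T y) * fderiv ℝ T y = 1 := by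
  have hcomp := (hasFDerivAt_diffeomorph T.symm (T y)).comp y (hasFDerivAt_diffeomorph T y)
  rw [funext (f := T.symm ∘ T) T.symm_apply_apply] at hcomp
  exact hcomp.unique (hasFDerivAt_id y)

theorem fderiv_mul_fderiv_symm (y : V) : fderiv ℝ T y * fderiv ℝ T.symm (T y) = 1 := by
  have hsymm := fderiv_symm_mul_fderiv T.symm (T y)
  rwa [T.symm_apply_apply] at hsymm

theorem inverse_fderiv_eq (y : V) : Ring.inverse (fderiv ℝ T y) = fderiv ℝ T.symm (T y) :=
  Ring.inverse_unit ⟨_, _, fderiv_mul_fderiv_symm T y, fderiv_symm_mul_fderiv T y⟩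

theorem det_fderiv_ne_zero (y : V) : (fderiv ℝ T y).det ≠ 0 := by
  have hdet : (fderiv ℝ T y).det * (fderiv ℝ T.symm (T y)).det = 1 := by
    simpa [ContinuousLinearMap.det] using
      congrArg ContinuousLinearMap.det (fderiv_mul_fderiv_symm T y)
  exact left_ne_zero_of_mul_eq_one hdet

/-- The Piola transform of the vector field `ψ • v` by the diffeomorphism `T`: testing the weak
gradient of `f` with it amounts to testing that of `f ∘ T⁻¹` with `ψ` in the direction `v`. -/
noncomputable def piolaField (ψ : V → ℝ) (v : V) (y : V) : V :=
  (|(fderiv ℝ T y).det| * ψ (T y)) • fderiv ℝ T.symm (T y) v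

variable {ψ : V → ℝ} (v : V)

theorem tsupport_piolaField_subset : tsupport (piolaField T ψ v) ⊆ T ⁻¹' tsupport ψ := by
  refine closure_minimal (fun y hy => ?_) ((isClosed_tsupport ψ).preimage T.continuous)
  by_contra hTy
  exact hy (by simp [piolaField, image_eq_zero_of_notMem_tsupport hTy])

theorem hasCompactSupport_piolaField (hψc : HasCompactSupport ψ) :
    HasCompactSupport (piolaField T ψ v) :=
  (T.toHomeomorph.isCompact_preimage.2 hψc).of_isClosed_subset (isClosed_tsupport _)
    (tsupport_piolaField_subset T v)

variable [FiniteDimensional ℝ V]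

theorem contDiff_abs_det_fderiv : ContDiff ℝ ∞ fun y => |(fderiv ℝ T y).det| :=
  (contDiff_det.comp (T.contDiff.fderiv_right (by simp))).abs (det_fderiv_ne_zero T)

theorem contDiff_piolaField (hψ : ContDiff ℝ ∞ ψ) : ContDiff ℝ ∞ (piolaField T ψ v) :=
  ((contDiff_abs_det_fderiv T).mul (hψ.comp T.contDiff)).smul <|
    ((T.symm.contDiff.fderiv_right (by simp)).comp T.contDiff).clm_apply contDiff_const

end Diffeomorph

variable [FiniteDimensional ℝ V]

/-- The divergence of a vector field, as the trace of its derivative. -/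
noncomputable def divergence (X : V → V) (y : V) : ℝ :=
  traceCLM V (fderiv ℝ X y)

theorem continuous_divergence {X : V → V} (hX : ContDiff ℝ ∞ X) : Continuous (divergence X) :=
  (traceCLM V).continuous.comp (hX.continuous_fderiv (by simp))

theorem divergence_eq_sum {ι : Type*} [Fintype ι] (b : Basis ι ℝ V) {X : V → V}
    (hX : Differentiable ℝ X) (y : V) :
    divergence X y = ∑ i, fderiv ℝ (fun y => b.coord i (X y)) y (b i) := by
  classical
  have coord_fderiv (i : ι) : HasFDerivAt (fun y => b.coord i (X y))
      ((b.coord i).toContinuousLinearMap ∘L fderiv ℝ X y) y :=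
    (b.coord i).toContinuousLinearMap.hasFDerivAt.comp y (hX y).hasFDerivAt
  rw [divergence, traceCLM_apply, LinearMap.trace_eq_matrix_trace ℝ b, Matrix.trace]
  refine Finset.sum_congr rfl fun i _ => ?_
  rw [(coord_fderiv i).fderiv, Matrix.diag_apply, LinearMap.toMatrix_apply]
  rfl

variable [MeasurableSpace V] [BorelSpace V] {μ : Measure V} {f : V → F} {g : V → V →L[ℝ] F}

theorem IsWeakGradOn.integral_divergence_smul (hfg : IsWeakGradOn μ Ω f g)
    (hf : LocallyIntegrable f μ) (hg : LocallyIntegrable g μ) {X : V → V} (hX : ContDiff ℝ ∞ X)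
    (hXc : HasCompactSupport X) (hXΩ : tsupport X ⊆ Ω) :
    ∫ y, divergence X y • f y ∂μ = -∫ y, g y (X y) ∂μ := by
  set b := finBasis ℝ V
  let c (i : Fin (finrank ℝ V)) (y : V) : ℝ := b.coord i (X y)
  have contDiff_c (i) : ContDiff ℝ ∞ (c i) := (b.coord i).toContinuousLinearMap.contDiff.comp hX
  have hasCompactSupport_c (i) : HasCompactSupport (c i) := hXc.comp_left (map_zero (b.coord i))
  have tsupport_c (i) : tsupport (c i) ⊆ Ω :=
    (tsupport_comp_subset (map_zero (b.coord i)) X).trans hXΩ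
  have integrable_left (i) : Integrable (fun y => fderiv ℝ (c i) y (b i) • f y) μ :=
    hf.integrable_smul_left_of_hasCompactSupport
      (((contDiff_c i).continuous_fderiv (by simp)).clm_apply continuous_const)
      ((hasCompactSupport_c i).fderiv_apply ℝ _)
  have integrable_right (i) : Integrable (fun y => c i y • g y (b i)) μ :=
    (ContinuousLinearMap.apply ℝ F (b i)).integrable_comp <|
      hg.integrable_smul_left_of_hasCompactSupport (contDiff_c i).continuous
        (hasCompactSupport_c i)
  have apply_X (y : V) : g y (X y) = ∑ i, c i y • g y (b i) := by
    conv_lhs => rw [← b.sum_repr (X y), map_sum]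
    simp [c]
  simp only [divergence_eq_sum b (hX.differentiable (by simp)), Finset.sum_smul, apply_X]
  rw [integral_finsetSum _ fun i _ => integrable_left i,
    integral_finsetSum _ fun i _ => integrable_right i, ← Finset.sum_neg_distrib]
  exact Finset.sum_congr rfl fun i _ =>
    hfg (c i) (contDiff_c i) (hasCompactSupport_c i) (tsupport_c i) (b i)

variable [μ.IsAddHaarMeasure]

theorem isWeakGradOn_fderiv {θ : V → F} (hθ : ContDiff ℝ ∞ θ) :
    IsWeakGradOn μ Ω θ (fderiv ℝ θ) := by
  intro φ hφ hφc _ v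
  have fderiv_φ : Continuous fun y => fderiv ℝ φ y v :=
    (hφ.continuous_fderiv (by simp)).clm_apply continuous_const
  have fderiv_θ : Continuous fun y => fderiv ℝ θ y v :=
    (hθ.continuous_fderiv (by simp)).clm_apply continuous_const
  rw [integral_smul_fderiv_eq_neg_fderiv_smul_of_integrable, neg_neg]
  · exact (fderiv_φ.smul hθ.continuous).integrable_of_hasCompactSupport
      (hφc.fderiv_apply ℝ v).smul_right
  · exact (hφ.continuous.smul fderiv_θ).integrable_of_hasCompactSupport hφc.smul_right
  · exact (hφ.continuous.smul hθ.continuous).integrable_of_hasCompactSupport hφc.smul_right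
  · exact fun y _ => hφ.differentiable (by simp) y
  · exact fun y _ => hθ.differentiable (by simp) y

section Diffeomorph

variable (T : V ≃ₘ[ℝ] V)

theorem integral_eq_integral_abs_det_fderiv_smul_comp (k : V → F) :
    ∫ z, k z ∂μ = ∫ y, |(fderiv ℝ T y).det| • k (T y) ∂μ := by
  simpa [Set.image_univ, T.surjective.range_eq] using
    integral_image_eq_integral_abs_det_fderiv_smul μ MeasurableSet.univ
      (fun y _ => (hasFDerivAt_diffeomorph T y).hasFDerivWithinAt) T.injective.injOn k

theorem map_symm_eq_withDensity :
    μ.map T.symm = μ.withDensity fun y => ENNReal.ofReal |(fderiv ℝ T y).det| := by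
  have map_eq := map_withDensity_abs_det_fderiv_eq_addHaar μ MeasurableSet.univ.nullMeasurableSet
    (fun y _ => (hasFDerivAt_diffeomorph T y).hasFDerivWithinAt) T.injective.injOn
  rw [Set.image_univ, show Set.range T = Set.univ from T.surjective.range_eq,
    Measure.restrict_univ] at map_eq
  conv_lhs => rw [← map_eq]
  rw [Measure.map_map T.symm.continuous.measurable T.continuous.measurable,
    funext (f := T.symm ∘ T) T.symm_apply_apply]
  exact Measure.map_id

variable {T}

theorem IsSupportedIn.exists_map_symm_le_smul (hT : IsSupportedIn T Ω) :
    ∃ C : ℝ, μ.map T.symm ≤ ENNReal.ofReal C • μ := by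
  obtain ⟨C, hC⟩ := hT.exists_forall_fderiv_le T.contDiff
    (contDiff_det (V := V)).continuous.abs
  refine ⟨C, ?_⟩
  rw [map_symm_eq_withDensity, ← withDensity_const]
  exact withDensity_mono (.of_forall fun y => ENNReal.ofReal_le_ofReal (hC y))

theorem IsSupportedIn.ae_comp_symm (hT : IsSupportedIn T Ω) {P : V → Prop}
    (h : ∀ᵐ y ∂μ, P y) : ∀ᵐ z ∂μ, P (T.symm z) := by
  obtain ⟨C, hC⟩ := hT.exists_map_symm_le_smul (μ := μ)
  exact ae_of_ae_map T.symm.continuous.measurable.aemeasurable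
    ((Measure.absolutelyContinuous_of_le_smul hC).ae_le h)

theorem IsSupportedIn.memLp_comp_symm {G : Type*} [NormedAddCommGroup G] {f : V → G}
    (hT : IsSupportedIn T Ω) {p : ℝ≥0∞} (hf : MemLp f p μ) : MemLp (fun z => f (T.symm z)) p μ := by
  obtain ⟨C, hC⟩ := hT.exists_map_symm_le_smul (μ := μ)
  exact (hf.of_measure_le_smul ENNReal.ofReal_ne_top hC).comp_of_map
    T.symm.continuous.measurable.aemeasurable

theorem IsSupportedIn.memLp_comp_fderiv_symm (hT : IsSupportedIn T Ω) {p : ℝ≥0∞}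
    (hg : MemLp g p μ) : MemLp (fun z => g (T.symm z) ∘L fderiv ℝ T.symm z) p μ := by
  obtain ⟨C, hC⟩ := hT.symm.exists_forall_fderiv_le T.symm.contDiff continuous_norm
  have continuous_comp : Continuous fun P : (V →L[ℝ] F) × (V →L[ℝ] V) => P.1 ∘L P.2 := by
    fun_prop
  have hmeas := (T.symm.contDiff.continuous_fderiv (by simp)).aestronglyMeasurable (μ := μ)
  have hcomp := hT.memLp_comp_symm hg
  refine MemLp.of_le_mul (c := C) hcomp
    (continuous_comp.comp_aestronglyMeasurable (hcomp.1.prodMk hmeas)) (.of_forall fun z => ?_)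
  rw [mul_comm]
  exact (opNorm_comp_le _ _).trans (by gcongr; exact hC z)

variable (T) {ψ : V → ℝ} (v : V)

theorem integral_fderiv_smul_comp_symm (f : V → F) :
    ∫ z, fderiv ℝ ψ z v • f (T.symm z) ∂μ =
      ∫ y, (|(fderiv ℝ T y).det| * fderiv ℝ ψ (T y) v) • f y ∂μ := by
  rw [integral_eq_integral_abs_det_fderiv_smul_comp T]
  simp only [T.symm_apply_apply, smul_smul]

theorem integral_smul_comp_fderiv_symm (g : V → V →L[ℝ] F) :
    ∫ z, ψ z • (g (T.symm z) ∘L fderiv ℝ T.symm z) v ∂μ = ∫ y, g y (piolaField T ψ v y) ∂μ := by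
  rw [integral_eq_integral_abs_det_fderiv_smul_comp T]
  simp only [T.symm_apply_apply, smul_smul, comp_apply, piolaField, map_smul]

-- Duality with smooth functions `θ`: the chain rule for `θ ∘ T⁻¹` is elementary.
theorem divergence_piolaField (hψ : ContDiff ℝ ∞ ψ) (hψc : HasCompactSupport ψ) (y : V) :
    divergence (piolaField T ψ v) y = |(fderiv ℝ T y).det| * fderiv ℝ ψ (T y) v := by
  let μ : Measure V := Measure.addHaar
  have hX := contDiff_piolaField T v hψ
  have hXc := hasCompactSupport_piolaField T v hψc
  have continuous_right : Continuous fun y => |(fderiv ℝ T y).det| * fderiv ℝ ψ (T y) v :=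
    (contDiff_abs_det_fderiv T).continuous.mul
      (((hψ.continuous_fderiv (by simp)).comp T.continuous).clm_apply continuous_const)
  have integral_eq (θ : V → ℝ) (hθ : ContDiff ℝ ∞ θ) :
      ∫ y, divergence (piolaField T ψ v) y • θ y ∂μ =
        ∫ y, (|(fderiv ℝ T y).det| * fderiv ℝ ψ (T y) v) • θ y ∂μ := by
    have fderiv_comp (z : V) : fderiv ℝ (fun z => θ (T.symm z)) z =
        fderiv ℝ θ (T.symm z) ∘L fderiv ℝ T.symm z :=
      ((hθ.differentiable (by simp) _).hasFDerivAt.comp z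
        (hasFDerivAt_diffeomorph T.symm z)).fderiv
    have weak := isWeakGradOn_fderiv (μ := μ) (Ω := Set.univ) (hθ.comp T.symm.contDiff) ψ hψ hψc
      (Set.subset_univ _) v
    simp only [Function.comp_def, fderiv_comp] at weak
    rw [(isWeakGradOn_fderiv (Ω := Set.univ) hθ).integral_divergence_smul
      hθ.continuous.locallyIntegrable (hθ.continuous_fderiv (by simp)).locallyIntegrable hX hXc
      (Set.subset_univ _), ← integral_fderiv_smul_comp_symm, weak, integral_smul_comp_fderiv_symm]
  have ae_eq := ae_eq_of_integral_contDiff_smul_eq (μ := μ)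
    (continuous_divergence hX).locallyIntegrable continuous_right.locallyIntegrable
    fun θ hθ _ => by simpa only [smul_eq_mul, mul_comm (θ _)] using integral_eq θ hθ
  exact congrFun (((continuous_divergence hX).ae_eq_iff_eq μ continuous_right).1 ae_eq) y

theorem IsWeakGradOn.comp_symm (hfg : IsWeakGradOn μ Ω f g) (hf : LocallyIntegrable f μ)
    (hg : LocallyIntegrable g μ) :
    IsWeakGradOn μ (T.symm ⁻¹' Ω) (fun z => f (T.symm z))
      fun z => g (T.symm z) ∘L fderiv ℝ T.symm z := by
  intro ψ hψ hψc hψΩ v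
  have tsupport_subset : tsupport (piolaField T ψ v) ⊆ Ω := fun y hy => by
    simpa using hψΩ (tsupport_piolaField_subset T v hy)
  rw [integral_fderiv_smul_comp_symm, integral_smul_comp_fderiv_symm,
    ← hfg.integral_divergence_smul hf hg (contDiff_piolaField T v hψ)
      (hasCompactSupport_piolaField T v hψc) tsupport_subset]
  simp only [divergence_piolaField T v hψ hψc]

end Diffeomorph

end DomainChange

section FirstVariation

open Module ContinuousLinearMap
open scoped Manifold

theorem eventually_forall_add_smul {α W : Type*} [NormedAddCommGroup W] [NormedSpace ℝ W]
    {A : α → W} {M : ℝ} (hA : ∀ y, ‖A y‖ ≤ M) {x : W} {p : W → Prop} (hp : ∀ᶠ w in 𝓝 x, p w) :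
    ∀ᶠ t in 𝓝 (0 : ℝ), ∀ y, p (x + t • A y) := by
  obtain ⟨ε, hε, hball⟩ := Metric.eventually_nhds_iff.1 hp
  have htM : Tendsto (fun t : ℝ => |t| * M) (𝓝 0) (𝓝 0) :=
    (continuous_abs.mul_const M).tendsto' _ _ (by simp)
  filter_upwards [htM.eventually (gt_mem_nhds hε)] with t ht y
  refine hball ?_
  rw [dist_self_add_left, norm_smul, Real.norm_eq_abs]
  exact (mul_le_mul_of_nonneg_left (hA y) (abs_nonneg t)).trans_lt ht

variable {V F : Type*} [NormedAddCommGroup V] [InnerProductSpace ℝ V] [FiniteDimensional ℝ V]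
  [NormedAddCommGroup F] [InnerProductSpace ℝ F] [CompleteSpace F]

section Integral

variable {α : Type*} [MeasurableSpace α] {μ : Measure α} {g : α → V →L[ℝ] F}

theorem aestronglyMeasurable_energyForm (hg : AEStronglyMeasurable g μ) {B : α → V →L[ℝ] V}
    (hB : AEStronglyMeasurable B μ) : AEStronglyMeasurable (fun y => energyForm (B y) (g y)) μ :=
  continuous_energyForm.comp_aestronglyMeasurable (f := fun y => (B y, g y)) (hB.prodMk hg)

theorem integrable_energyForm (hg : MemLp g 2 μ) {B : α → V →L[ℝ] V}
    (hB : AEStronglyMeasurable B μ) {C : ℝ} (hC : ∀ y, ‖B y‖ ≤ C) :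
    Integrable (fun y => energyForm (B y) (g y)) μ := by
  refine ((hg.integrable_norm_pow two_ne_zero).const_mul (‖traceCLM V‖ * C)).mono'
    (aestronglyMeasurable_energyForm hg.1 hB) (.of_forall fun y => ?_)
  exact (abs_energyForm_le _ _).trans (by gcongr; exact hC y)

theorem integrable_energyForm_one (hg : MemLp g 2 μ) :
    Integrable (fun y => energyForm 1 (g y)) μ :=
  integrable_energyForm hg aestronglyMeasurable_const fun _ => le_rfl

end Integral

theorem eventually_continuousAt_pullbackCoeff :
    ∀ᶠ P : V →L[ℝ] V in 𝓝 1, ContinuousAt pullbackCoeff P := by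
  filter_upwards [Units.nhds (1 : (V →L[ℝ] V)ˣ)] with P hP
  have hinv := NormedRing.inverse_continuousAt hP.unit
  have hadj : ContinuousAt (fun P : V →L[ℝ] V => adjoint (Ring.inverse P)) P :=
    (adjointCLM V).continuous.continuousAt.comp hinv
  exact contDiff_det.continuous.abs.continuousAt.smul (hinv.clm_comp hadj)

theorem hasDerivAt_energyForm_pullbackCoeff (A : V →L[ℝ] V) (G : V →L[ℝ] F) :
    HasDerivAt (fun t : ℝ => energyForm (pullbackCoeff (1 + t • A)) G)
      (energyForm (pullbackCoeffDeriv V A) G) 0 := by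
  have hline : HasDerivAt (fun t : ℝ => 1 + t • A) A 0 := by
    simpa using ((hasDerivAt_id (0 : ℝ)).smul_const A).const_add 1
  have hcoeff : HasDerivAt (fun t : ℝ => pullbackCoeff (1 + t • A)) (pullbackCoeffDeriv V A) 0 :=
    HasFDerivAt.comp_hasDerivAt_of_eq (l := pullbackCoeff) 0 hasFDerivAt_pullbackCoeff_one hline
      (by simp)
  exact ((traceCLM V).hasFDerivAt.comp_hasDerivAt 0
    (hcoeff.clm_comp (hasDerivAt_const 0 (adjoint G ∘L G)))).congr_deriv (by simp [energyForm])

theorem exists_eventually_abs_energyForm_pullbackCoeff_sub_le {α : Type*} {A : α → V →L[ℝ] V}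
    {M : ℝ} (hA : ∀ y, ‖A y‖ ≤ M) : ∃ C, ∀ᶠ t in 𝓝 (0 : ℝ), ∀ y (G : V →L[ℝ] F),
      |energyForm (pullbackCoeff (1 + t • A y)) G - energyForm 1 G| ≤ C * ‖G‖ ^ 2 * |t| := by
  obtain ⟨c, hc⟩ := (hasFDerivAt_pullbackCoeff_one (V := V)).isBigO_sub.bound
  refine ⟨‖traceCLM V‖ * (|c| * M), ?_⟩
  filter_upwards [eventually_forall_add_smul hA hc] with t ht y G
  have hty := ht y
  rw [pullbackCoeff_one, add_sub_cancel_left, norm_smul, Real.norm_eq_abs] at hty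
  rw [← energyForm_sub]
  calc _ ≤ ‖traceCLM V‖ * (c * (|t| * ‖A y‖)) * ‖G‖ ^ 2 :=
        (abs_energyForm_le _ _).trans (by gcongr)
    _ ≤ ‖traceCLM V‖ * (|c| * (|t| * M)) * ‖G‖ ^ 2 := by
        gcongr
        · exact le_abs_self c
        · exact hA y
    _ = _ := by ring

theorem hasDerivAt_integral_energyForm_pullbackCoeff {α : Type*} [TopologicalSpace α]
    [SecondCountableTopology α] [MeasurableSpace α] [OpensMeasurableSpace α] {μ : Measure α}
    {g : α → V →L[ℝ] F} (hg : MemLp g 2 μ) {A : α → V →L[ℝ] V} (hAc : Continuous A) {M : ℝ}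
    (hA : ∀ y, ‖A y‖ ≤ M) :
    HasDerivAt (fun t : ℝ => ∫ y, energyForm (pullbackCoeff (1 + t • A y)) (g y) ∂μ)
      (∫ y, energyForm (pullbackCoeffDeriv V (A y)) (g y) ∂μ) 0 := by
  obtain ⟨C, hC⟩ := exists_eventually_abs_energyForm_pullbackCoeff_sub_le (F := F) hA
  have meas_coeff (t : ℝ) (ht : ∀ y, ContinuousAt pullbackCoeff (1 + t • A y)) :
      AEStronglyMeasurable (fun y => energyForm (pullbackCoeff (1 + t • A y)) (g y)) μ := by
    have hcont : Continuous fun y => pullbackCoeff (1 + t • A y) :=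
      continuous_iff_continuousAt.2 fun y => (ht y).comp (f := fun y => 1 + t • A y) (by fun_prop)
    exact aestronglyMeasurable_energyForm hg.1 hcont.aestronglyMeasurable
  have meas_deriv : AEStronglyMeasurable
      (fun y => energyForm (pullbackCoeffDeriv V (A y)) (g y)) μ :=
    aestronglyMeasurable_energyForm hg.1
      ((pullbackCoeffDeriv V).continuous.comp hAc).aestronglyMeasurable
  have hderiv := hasFDerivAt_integral_of_dominated_loc_of_lip'
    (F' := fun y => toSpanSingleton ℝ (energyForm (pullbackCoeffDeriv V (A y)) (g y)))
    (hC.and (eventually_forall_add_smul hA eventually_continuousAt_pullbackCoeff))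
    (fun t ht => meas_coeff t ht.2)
    (by simpa [pullbackCoeff_one] using integrable_energyForm_one hg)
    ((toSpanSingletonCLE (𝕜 := ℝ) (E := ℝ)).continuous.comp_aestronglyMeasurable meas_deriv)
    (.of_forall fun y t ht => by simpa [pullbackCoeff_one] using ht.1 y (g y))
    ((hg.integrable_norm_pow two_ne_zero).const_mul C)
    (.of_forall fun y => (hasDerivAt_energyForm_pullbackCoeff (A y) (g y)).hasFDerivAt)
  simpa [integral_apply hderiv.1] using hderiv.2.hasDerivAt

theorem exists_diffeomorph_add_smul {X : V → V} (hX : ContDiff ℝ ∞ X) (hXc : HasCompactSupport X) :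
    ∀ᶠ t in 𝓝 (0 : ℝ), ∃ T : V ≃ₘ[ℝ] V, ∀ y, T y = y + t • X y := by
  obtain ⟨M, hM⟩ := (hXc.fderiv ℝ).exists_bound_of_continuous (hX.continuous_fderiv (by simp))
  have norm_lt : ∀ᶠ P : V →L[ℝ] V in 𝓝 0, ‖P‖ < 1 / 2 :=
    continuous_norm.tendsto' _ _ norm_zero |>.eventually (gt_mem_nhds (by norm_num))
  filter_upwards [eventually_forall_add_smul hM norm_lt,
    eventually_forall_add_smul hM (Units.nhds (1 : (V →L[ℝ] V)ˣ))] with t hsmall hunit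
  have hXd := hX.differentiable (by simp)
  have hlip : LipschitzWith (1 / 2) (t • X) :=
    lipschitzWith_of_nnnorm_fderiv_le (hXd.const_smul t) fun y => by
      have := (hsmall y).le
      rw [zero_add] at this
      rw [fderiv_const_smul (hXd y), ← NNReal.coe_le_coe]
      simpa using this
  have happrox : ApproximatesLinearOn (fun y => y + t • X y)
      (ContinuousLinearEquiv.refl ℝ V : V →L[ℝ] V) Set.univ (1 / 2) := by
    rw [ApproximatesLinearOn.approximatesLinearOn_iff_lipschitzOnWith, lipschitzOnWith_univ]
    convert hlip using 1
    ext y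
    simp
  have hc : Subsingleton V ∨
      (1 / 2 : NNReal) < ‖((ContinuousLinearEquiv.refl ℝ V).symm : V →L[ℝ] V)‖₊⁻¹ := by
    rcases subsingleton_or_nontrivial V with hV | hV
    · exact .inl hV
    · right
      rw [← NNReal.coe_lt_coe]
      simp
      norm_num
  let h : V ≃ₜ V := happrox.toHomeomorph _ hc
  have h_contDiff : ContDiff ℝ ∞ h := contDiff_id.add (hX.const_smul t)
  have h_symm : ContDiff ℝ ∞ h.symm :=
    h.contDiff_symm (f₀' := fun y => ContinuousLinearEquiv.ofUnit (hunit y).unit)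
      (fun y => (hasFDerivAt_id y).add ((hXd y).hasFDerivAt.const_smul t)) h_contDiff
  exact ⟨⟨h.toEquiv, h_contDiff.contMDiff, h_symm.contMDiff⟩, fun y => rfl⟩

variable [MeasurableSpace V] [BorelSpace V] {μ : Measure V} [μ.IsAddHaarMeasure] {Ω : Set V}
  {g : V → V →L[ℝ] F}

theorem integral_energyForm_comp_fderiv_symm (T : V ≃ₘ[ℝ] V) :
    ∫ z, energyForm 1 (g (T.symm z) ∘L fderiv ℝ T.symm z) ∂μ =
      ∫ y, energyForm (pullbackCoeff (fderiv ℝ T y)) (g y) ∂μ := by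
  rw [integral_eq_integral_abs_det_fderiv_smul_comp T]
  simp only [T.symm_apply_apply, ← inverse_fderiv_eq, smul_eq_mul,
    abs_det_mul_energyForm_comp_inverse]

/-- The field `g` has least energy among its transforms under the diffeomorphisms that are the
identity near the boundary of `Ω`: no inner variation of a map with gradient `g` lowers the
energy. -/
def IsInnerMinimizing (μ : Measure V) (Ω : Set V) (g : V → V →L[ℝ] F) : Prop :=
  ∀ T : V ≃ₘ[ℝ] V, IsSupportedIn T Ω →
    ∫ y, energyForm 1 (g y) ∂μ ≤ ∫ z, energyForm 1 (g (T.symm z) ∘L fderiv ℝ T.symm z) ∂μ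

/-- The field `g` satisfies the equation of inner variations in `Ω`: the energy of a map with
gradient `g` is critical under the flows of the smooth vector fields with compact support
in `Ω`. -/
def IsStationary (μ : Measure V) (Ω : Set V) (g : V → V →L[ℝ] F) : Prop :=
  ∀ X : V → V, ContDiff ℝ ∞ X → HasCompactSupport X → tsupport X ⊆ Ω →
    ∫ y, energyForm (pullbackCoeffDeriv V (fderiv ℝ X y)) (g y) ∂μ = 0

theorem IsInnerMinimizing.isStationary (hmin : IsInnerMinimizing μ Ω g) (hg : MemLp g 2 μ) :
    IsStationary μ Ω g := by
  intro X hX hXc hXΩ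
  have hXd := hX.continuous_fderiv (by simp)
  obtain ⟨M, hM⟩ := (hXc.fderiv ℝ).exists_bound_of_continuous hXd
  refine IsLocalMin.hasDerivAt_eq_zero ?_
    (hasDerivAt_integral_energyForm_pullbackCoeff hg hXd hM)
  filter_upwards [exists_diffeomorph_add_smul hX hXc] with t ⟨T, hT⟩
  have hsupp : IsSupportedIn T Ω := ⟨tsupport X, hXΩ, hXc, fun y hy => by
    rw [hT, image_eq_zero_of_notMem_tsupport hy, smul_zero, add_zero]⟩
  have hfderiv (y : V) : fderiv ℝ T y = 1 + t • fderiv ℝ X y := by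
    rw [funext hT]
    exact ((hasFDerivAt_id y).add
      ((hX.differentiable (by simp) y).hasFDerivAt.const_smul t)).fderiv
  simpa only [integral_energyForm_comp_fderiv_symm, hfderiv, zero_smul, add_zero,
    pullbackCoeff_one] using hmin T hsupp

end FirstVariation

section RadialVariation

open Module ContinuousLinearMap InnerProductSpace Set

section Cutoff

variable {W : Type*} [NormedAddCommGroup W] [NormedSpace ℝ W] [FiniteDimensional ℝ W] {s : Set W}

theorem exists_contDiff_tendsto_indicator_one (hs : IsOpen s) :
    ∃ χ : ℕ → W → ℝ, (∀ k, ContDiff ℝ ∞ (χ k)) ∧ (∀ k, Function.support (χ k) ⊆ s) ∧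
      (∀ k x, χ k x ∈ Icc 0 1) ∧ ∀ x, Tendsto (χ · x) atTop (𝓝 (s.indicator 1 x)) := by
  obtain ⟨φ, hφ_supp, hφ, hφ_range⟩ := hs.exists_contDiff_support_eq (n := ⊤)
  have hφ_nonneg (x : W) : 0 ≤ φ x := (hφ_range (mem_range_self x)).1
  have hχ_zero (k : ℕ) {x : W} (hx : x ∉ s) : Real.smoothTransition (k * φ x) = 0 := by
    rw [← hφ_supp, Function.notMem_support] at hx
    rw [hx, mul_zero, Real.smoothTransition.zero]
  refine ⟨fun k x => Real.smoothTransition (k * φ x),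
    fun k => Real.smoothTransition.contDiff.comp (contDiff_const.mul hφ),
    fun k x hx => by_contra fun hxs => hx (hχ_zero k hxs),
    fun k x => ⟨Real.smoothTransition.nonneg _, Real.smoothTransition.le_one _⟩, fun x => ?_⟩
  by_cases hx : x ∈ s
  · have hφx : 0 < φ x := (hφ_nonneg x).lt_of_ne' (hφ_supp.symm ▸ hx :)
    rw [indicator_of_mem hx, Pi.one_apply]
    refine tendsto_const_nhds.congr' ?_
    filter_upwards [(tendsto_natCast_atTop_atTop.atTop_mul_const hφx).eventually_ge_atTop 1]
      with k hk
    exact (Real.smoothTransition.one_of_one_le hk).symm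
  · simp only [hχ_zero _ hx, indicator_of_notMem hx, tendsto_const_nhds]

theorem exists_contDiff_tendsto_indicator (hs : IsOpen s) {f : W → ℝ}
    (hf : ∀ x ∈ closure s, ContDiffAt ℝ ∞ f x) {C : ℝ} (hC : 0 ≤ C) (hfC : ∀ x ∈ s, |f x| ≤ C) :
    ∃ w : ℕ → W → ℝ, (∀ k, ContDiff ℝ ∞ (w k)) ∧ (∀ k, Function.support (w k) ⊆ s) ∧
      (∀ k x, |w k x| ≤ C) ∧ ∀ x, Tendsto (w · x) atTop (𝓝 (s.indicator f x)) := by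
  obtain ⟨χ, hχ, hχ_supp, hχ_mem, hχ_lim⟩ := exists_contDiff_tendsto_indicator_one hs
  have hχ_zero (k : ℕ) {x : W} (hx : x ∉ s) : χ k x = 0 :=
    Function.notMem_support.1 fun h => hx (hχ_supp k h)
  refine ⟨fun k x => χ k x * f x, fun k => contDiff_iff_contDiffAt.2 fun x => ?_,
    fun k => (Function.support_mul_subset_left _ _).trans (hχ_supp k), fun k x => ?_, fun x => ?_⟩
  · by_cases hx : x ∈ closure s
    · exact (hχ k).contDiffAt.mul (hf x hx)
    · refine (contDiffAt_const (c := (0 : ℝ))).congr_of_eventuallyEq ?_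
      filter_upwards [isClosed_closure.isOpen_compl.mem_nhds hx] with y hy
      rw [hχ_zero k fun h => hy (subset_closure h), zero_mul]
  · by_cases hx : x ∈ s
    · rw [abs_mul, abs_of_nonneg (hχ_mem k x).1]
      exact (mul_le_of_le_one_left (abs_nonneg _) (hχ_mem k x).2).trans (hfC x hx)
    · simpa [hχ_zero k hx] using hC
  · by_cases hx : x ∈ s <;> simpa [hx] using (hχ_lim x).mul_const (f x)

end Cutoff

section Profile

variable {w : ℝ → ℝ} {c s : ℝ}

/-- The primitive of `-w / 2` vanishing at `c`: for a weight `w` living on `τ < c`, the radial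
field `profile w (ρ ^ 2) (‖y - x‖ ^ 2) • (y - x)` is supported in the ball of radius `ρ`. -/
noncomputable def profile (w : ℝ → ℝ) (c s : ℝ) : ℝ := 1 / 2 * ∫ τ in s..c, w τ

theorem hasDerivAt_profile (hw : Continuous w) :
    HasDerivAt (profile w c) (-(1 / 2) * w s) s :=
  ((intervalIntegral.integral_hasDerivAt_left (hw.intervalIntegrable s c)
    (hw.stronglyMeasurableAtFilter _ _) hw.continuousAt).const_mul (1 / 2 : ℝ)).congr_deriv
    (by ring)

theorem contDiff_profile (hw : ContDiff ℝ ∞ w) : ContDiff ℝ ∞ (profile w c) := by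
  have hderiv : deriv (profile w c) = fun s => -(1 / 2) * w s :=
    funext fun s => (hasDerivAt_profile hw.continuous).deriv
  rw [contDiff_infty_iff_deriv, hderiv]
  exact ⟨fun s => (hasDerivAt_profile hw.continuous).differentiableAt, contDiff_const.mul hw⟩

theorem profile_eq_zero (hw : ∀ τ, c ≤ τ → w τ = 0) (hs : c ≤ s) : profile w c s = 0 := by
  have hzero : EqOn w (fun _ => 0) (uIcc s c) := fun τ hτ => hw τ (uIcc_of_ge hs ▸ hτ :).1
  rw [profile, intervalIntegral.integral_congr hzero, intervalIntegral.integral_zero, mul_zero]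

theorem abs_profile_le {C : ℝ} (hw : ∀ τ, c ≤ τ → w τ = 0) (hwC : ∀ τ, |w τ| ≤ C) (hc : 0 ≤ c)
    (hs : 0 ≤ s) : |profile w c s| ≤ C * c := by
  have hC : 0 ≤ C := (abs_nonneg _).trans (hwC 0)
  rcases le_total c s with h | h
  · rw [profile_eq_zero hw h, abs_zero]
    positivity
  · have hint : |∫ τ in s..c, w τ| ≤ C * |c - s| :=
      intervalIntegral.norm_integral_le_of_norm_le_const (f := w) fun τ _ => hwC τ
    rw [abs_of_nonneg (sub_nonneg.2 h)] at hint
    rw [profile, abs_mul, abs_of_pos one_half_pos]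
    nlinarith [mul_nonneg hC hs, mul_nonneg hC hc]

theorem tendsto_profile {w : ℕ → ℝ → ℝ} {w₀ : ℝ → ℝ} {C : ℝ} (hw : ∀ k, Continuous (w k))
    (hwC : ∀ k τ, |w k τ| ≤ C) (hlim : ∀ τ, Tendsto (w · τ) atTop (𝓝 (w₀ τ))) :
    Tendsto (fun k => profile (w k) c s) atTop (𝓝 (profile w₀ c s)) :=
  (intervalIntegral.tendsto_integral_filter_of_dominated_convergence (fun _ => C)
    (.of_forall fun k => (hw k).aestronglyMeasurable)
    (.of_forall fun k => .of_forall fun τ _ => hwC k τ)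
    intervalIntegrable_const (.of_forall fun τ _ => hlim τ)).const_mul _

end Profile

theorem hasFDerivAt_radial {V : Type*} [NormedAddCommGroup V] [InnerProductSpace ℝ V]
    {η : ℝ → ℝ} {η' : ℝ} {x y : V} (hη : HasDerivAt η η' (‖y - x‖ ^ 2)) :
    HasFDerivAt (fun y => η (‖y - x‖ ^ 2) • (y - x))
      (η (‖y - x‖ ^ 2) • 1 + (2 * η') • rankOne ℝ (y - x) (y - x)) y := by
  have hsub : HasFDerivAt (fun y => y - x) (1 : V →L[ℝ] V) y := (hasFDerivAt_id y).sub_const x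
  refine ((hη.comp_hasFDerivAt y hsub.norm_sq).smul hsub).congr_fderiv ?_
  ext v
  simp only [Function.comp_apply, map_sub, sub_comp, add_apply, smul_apply, one_apply_eq_self,
    smulRight_apply, sub_apply, comp_apply, coe_innerSL_apply, nsmul_eq_mul, Nat.cast_ofNat,
    smul_eq_mul, rankOne_apply, add_right_inj]
  module

variable {V F : Type*} [NormedAddCommGroup V] [InnerProductSpace ℝ V] [FiniteDimensional ℝ V]
  [NormedAddCommGroup F] [InnerProductSpace ℝ F] [CompleteSpace F]

theorem energyForm_rankOne (d : V) (G : V →L[ℝ] F) :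
    energyForm (rankOne ℝ d d) G = ‖G d‖ ^ 2 := by
  rw [energyForm, traceCLM_apply, rankOne_comp, trace_rankOne, adjoint_comp, adjoint_adjoint,
    comp_apply, adjoint_inner_left, real_inner_self_eq_norm_sq]

theorem energyForm_pullbackCoeffDeriv_radial (a c : ℝ) (d : V) (G : V →L[ℝ] F) :
    energyForm (pullbackCoeffDeriv V (a • 1 + c • rankOne ℝ d d)) G =
      ((finrank ℝ V - 2) * a + c * ‖d‖ ^ 2) * energyForm 1 G - 2 * c * ‖G d‖ ^ 2 := by
  have hcoeff : pullbackCoeffDeriv V (a • 1 + c • rankOne ℝ d d) =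
      ((finrank ℝ V - 2) * a + c * ‖d‖ ^ 2) • 1 - (2 * c) • rankOne ℝ d d := by
    rw [pullbackCoeffDeriv_apply, map_add, map_smul, map_smul]
    have htrace : traceCLM V 1 = finrank ℝ V := LinearMap.trace_one ℝ V
    have htrace' : traceCLM V (rankOne ℝ d d) = ‖d‖ ^ 2 := by
      rw [traceCLM_apply, trace_rankOne, real_inner_self_eq_norm_sq]
    rw [htrace, htrace', map_add, map_smulₛₗ, map_smulₛₗ, adjoint_rankOne]
    have : adjoint (1 : V →L[ℝ] V) = 1 := adjoint_one
    rw [this]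
    simp only [smul_eq_mul, Real.ringHom_apply]
    module
  rw [hcoeff, energyForm_sub, energyForm_smul, energyForm_smul, energyForm_rankOne]

/-- The first variation density `energyForm (pullbackCoeffDeriv V (fderiv ℝ X y)) G` of the radial
field `X = profile w c (‖y - x‖ ^ 2) • (y - x)`, as a function of `d = y - x`. -/
noncomputable def radialDensity (w : ℝ → ℝ) (c : ℝ) (d : V) (G : V →L[ℝ] F) : ℝ :=
  ((finrank ℝ V - 2) * profile w c (‖d‖ ^ 2) - w (‖d‖ ^ 2) * ‖d‖ ^ 2) * energyForm 1 G +
    2 * w (‖d‖ ^ 2) * ‖G d‖ ^ 2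

theorem energyForm_pullbackCoeffDeriv_fderiv_profile {w : ℝ → ℝ} (hw : Continuous w) (c : ℝ)
    (x y : V) (G : V →L[ℝ] F) :
    energyForm (pullbackCoeffDeriv V
      (fderiv ℝ (fun y => profile w c (‖y - x‖ ^ 2) • (y - x)) y)) G =
      radialDensity w c (y - x) G := by
  rw [(hasFDerivAt_radial (hasDerivAt_profile hw)).fderiv, energyForm_pullbackCoeffDeriv_radial,
    radialDensity]
  ring

theorem continuous_radialDensity {w : ℝ → ℝ} (hw : Continuous w) (c : ℝ) :
    Continuous fun p : V × (V →L[ℝ] F) => radialDensity w c p.1 p.2 := by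
  have hprofile : Continuous (profile w c) :=
    continuous_iff_continuousAt.2 fun s => (hasDerivAt_profile hw).continuousAt
  have henergy : Continuous fun p : V × (V →L[ℝ] F) => energyForm 1 p.2 :=
    continuous_energyForm.comp (continuous_const.prodMk continuous_snd)
  unfold radialDensity
  fun_prop

theorem abs_radialDensity_le {w : ℝ → ℝ} {c C : ℝ} (hw : ∀ τ, c ≤ τ → w τ = 0)
    (hwC : ∀ τ, |w τ| ≤ C) (hc : 0 ≤ c) (d : V) (G : V →L[ℝ] F) :
    |radialDensity w c d G| ≤ C * c *
      ((|(finrank ℝ V : ℝ) - 2| + 1) * (‖traceCLM V‖ * ‖(1 : V →L[ℝ] V)‖) + 2) * ‖G‖ ^ 2 := by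
  have hC : 0 ≤ C := (abs_nonneg _).trans (hwC 0)
  have hwd : |w (‖d‖ ^ 2)| * ‖d‖ ^ 2 ≤ C * c := by
    rcases le_total c (‖d‖ ^ 2) with h | h
    · rw [hw _ h, abs_zero, zero_mul]
      positivity
    · exact mul_le_mul (hwC _) h (by positivity) hC
  have hcoeff : |(finrank ℝ V - 2) * profile w c (‖d‖ ^ 2) - w (‖d‖ ^ 2) * ‖d‖ ^ 2| ≤
      |(finrank ℝ V : ℝ) - 2| * (C * c) + C * c := by
    refine (abs_sub _ _).trans ?_
    rw [abs_mul, abs_mul, abs_of_nonneg (sq_nonneg ‖d‖)]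
    gcongr
    exact abs_profile_le hw hwC hc (sq_nonneg _)
  have hradial : |w (‖d‖ ^ 2)| * ‖G d‖ ^ 2 ≤ C * c * ‖G‖ ^ 2 := by
    calc _ ≤ |w (‖d‖ ^ 2)| * (‖G‖ * ‖d‖) ^ 2 := by gcongr; exact G.le_opNorm d
      _ = |w (‖d‖ ^ 2)| * ‖d‖ ^ 2 * ‖G‖ ^ 2 := by ring
      _ ≤ _ := by gcongr
  calc |radialDensity w c d G|
      ≤ |(finrank ℝ V - 2) * profile w c (‖d‖ ^ 2) - w (‖d‖ ^ 2) * ‖d‖ ^ 2| * |energyForm 1 G| +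
          2 * (|w (‖d‖ ^ 2)| * ‖G d‖ ^ 2) := by
        refine (abs_add_le _ _).trans_eq ?_
        rw [abs_mul, abs_mul, abs_mul, abs_two, abs_of_nonneg (sq_nonneg ‖G d‖), mul_assoc]
    _ ≤ (|(finrank ℝ V : ℝ) - 2| * (C * c) + C * c) *
          (‖traceCLM V‖ * ‖(1 : V →L[ℝ] V)‖ * ‖G‖ ^ 2) + 2 * (C * c * ‖G‖ ^ 2) := by
        gcongr
        exact abs_energyForm_le 1 G
    _ = _ := by ring

theorem tendsto_radialDensity {w : ℕ → ℝ → ℝ} {w₀ : ℝ → ℝ} {C : ℝ} (hw : ∀ k, Continuous (w k))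
    (hwC : ∀ k τ, |w k τ| ≤ C) (hlim : ∀ τ, Tendsto (w · τ) atTop (𝓝 (w₀ τ))) (c : ℝ) (d : V)
    (G : V →L[ℝ] F) :
    Tendsto (fun k => radialDensity (w k) c d G) atTop (𝓝 (radialDensity w₀ c d G)) :=
  ((((tendsto_profile hw hwC hlim).const_mul _).sub ((hlim _).mul_const _)).mul_const _).add
    (((hlim _).const_mul 2).mul_const _)

variable [MeasurableSpace V] {μ : Measure V} {Ω : Set V} {g : V → V →L[ℝ] F}
  {x : V} {ρ : ℝ}

theorem IsStationary.integral_radialDensity_eq_zero (h : IsStationary μ Ω g) (hρ : 0 ≤ ρ)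
    (hxρ : Metric.closedBall x ρ ⊆ Ω) {w : ℝ → ℝ} (hw : ContDiff ℝ ∞ w)
    (hw_zero : ∀ τ, ρ ^ 2 ≤ τ → w τ = 0) :
    ∫ y, radialDensity w (ρ ^ 2) (y - x) (g y) ∂μ = 0 := by
  set X : V → V := fun y => profile w (ρ ^ 2) (‖y - x‖ ^ 2) • (y - x)
  have hX : ContDiff ℝ ∞ X := by
    have hsub : ContDiff ℝ ∞ fun y : V => y - x := contDiff_id.sub contDiff_const
    exact ((contDiff_profile hw).comp (hsub.norm_sq ℝ)).smul hsub
  have hX_supp : tsupport X ⊆ Metric.closedBall x ρ := by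
    refine closure_minimal (fun y hy => ?_) Metric.isClosed_closedBall
    rw [mem_closedBall_iff_norm]
    by_contra! hlt
    exact hy (by simp only [X, profile_eq_zero hw_zero (pow_le_pow_left₀ hρ hlt.le 2), zero_smul])
  have hXc : HasCompactSupport X :=
    (isCompact_closedBall x ρ).of_isClosed_subset (isClosed_tsupport _) hX_supp
  rw [← h X hX hXc (hX_supp.trans hxρ)]
  simp only [X, energyForm_pullbackCoeffDeriv_fderiv_profile hw.continuous]

theorem IsStationary.integral_radialDensity_eq_zero_of_tendsto [BorelSpace V]
    (h : IsStationary μ Ω g)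
    (hg : MemLp g 2 μ) (hρ : 0 ≤ ρ) (hxρ : Metric.closedBall x ρ ⊆ Ω) {w : ℕ → ℝ → ℝ}
    {w₀ : ℝ → ℝ} {C : ℝ} (hw : ∀ k, ContDiff ℝ ∞ (w k))
    (hw_zero : ∀ k τ, ρ ^ 2 ≤ τ → w k τ = 0) (hwC : ∀ k τ, |w k τ| ≤ C)
    (hlim : ∀ τ, Tendsto (w · τ) atTop (𝓝 (w₀ τ))) :
    ∫ y, radialDensity w₀ (ρ ^ 2) (y - x) (g y) ∂μ = 0 := by
  have hmeas (k : ℕ) :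
      AEStronglyMeasurable (fun y => radialDensity (w k) (ρ ^ 2) (y - x) (g y)) μ :=
    (continuous_radialDensity (hw k).continuous (ρ ^ 2)).comp_aestronglyMeasurable
      (f := fun y => (y - x, g y))
      ((continuous_id.sub continuous_const).aestronglyMeasurable.prodMk hg.1)
  have hlim_int := tendsto_integral_of_dominated_convergence _ hmeas
    ((hg.integrable_norm_pow two_ne_zero).const_mul _)
    (fun k => .of_forall fun y =>
      abs_radialDensity_le (hw_zero k) (hwC k) (sq_nonneg ρ) (y - x) (g y))
    (.of_forall fun y =>
      tendsto_radialDensity (fun k => (hw k).continuous) hwC hlim (ρ ^ 2) (y - x) (g y))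
  simp only [h.integral_radialDensity_eq_zero hρ hxρ (hw _) (hw_zero _)] at hlim_int
  exact tendsto_nhds_unique hlim_int tendsto_const_nhds

end RadialVariation

section Monotonicity

open Module Set Metric

section AnnulusWeight

variable {m : ℕ} {σ ρ R : ℝ}

/-- The weight `R ^ (-m)` on the annulus `σ < R < ρ`, as a function of `τ = R ^ 2`. With this
weight the coefficient of the energy density in `radialDensity` is locally constant away from the
annulus, and on the annulus it equals `-ρ ^ (2 - m)`. -/
noncomputable def annulusWeight (m : ℕ) (σ ρ τ : ℝ) : ℝ :=
  (Ioo (σ ^ 2) (ρ ^ 2)).indicator (fun τ => (√τ ^ m)⁻¹) τ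

theorem annulusWeight_sq_of_mem (hσ : 0 ≤ σ) (hR : R ∈ Ioo σ ρ) :
    annulusWeight m σ ρ (R ^ 2) = (R ^ m)⁻¹ := by
  have hR0 : 0 ≤ R := hσ.trans hR.1.le
  have hmem : R ^ 2 ∈ Ioo (σ ^ 2) (ρ ^ 2) :=
    ⟨pow_lt_pow_left₀ hR.1 hσ two_ne_zero, pow_lt_pow_left₀ hR.2 hR0 two_ne_zero⟩
  rw [annulusWeight, indicator_of_mem hmem, Real.sqrt_sq hR0]

theorem annulusWeight_sq_of_le (hR : 0 ≤ R) (hRσ : R ≤ σ) : annulusWeight m σ ρ (R ^ 2) = 0 :=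
  indicator_of_notMem (fun h => h.1.not_ge (pow_le_pow_left₀ hR hRσ 2)) _

theorem annulusWeight_eq_zero {τ : ℝ} (hτ : ρ ^ 2 ≤ τ) : annulusWeight m σ ρ τ = 0 :=
  indicator_of_notMem (fun h => h.2.not_ge hτ) _

theorem exists_contDiff_tendsto_annulusWeight (hσ : 0 < σ) :
    ∃ w : ℕ → ℝ → ℝ, (∀ k, ContDiff ℝ ∞ (w k)) ∧ (∀ k τ, ρ ^ 2 ≤ τ → w k τ = 0) ∧
      (∀ k τ, |w k τ| ≤ (σ ^ m)⁻¹) ∧ ∀ τ, Tendsto (w · τ) atTop (𝓝 (annulusWeight m σ ρ τ)) := by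
  have hsmooth : ∀ τ ∈ closure (Ioo (σ ^ 2) (ρ ^ 2)), ContDiffAt ℝ ∞ (fun τ => (√τ ^ m)⁻¹) τ := by
    intro τ hτ
    have hτ0 : 0 < τ :=
      (pow_pos hσ 2).trans_le (closure_minimal Ioo_subset_Icc_self isClosed_Icc hτ).1
    exact ((Real.contDiffAt_sqrt hτ0.ne').pow m).inv (pow_pos (Real.sqrt_pos.2 hτ0) m).ne'
  have hbound : ∀ τ ∈ Ioo (σ ^ 2) (ρ ^ 2), |(√τ ^ m)⁻¹| ≤ (σ ^ m)⁻¹ := by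
    intro τ hτ
    rw [abs_of_nonneg (by positivity)]
    gcongr
    exact Real.le_sqrt_of_sq_le hτ.1.le
  obtain ⟨w, hw, hw_supp, hwC, hlim⟩ :=
    exists_contDiff_tendsto_indicator isOpen_Ioo hsmooth (by positivity) hbound
  exact ⟨w, hw, fun k τ hτ => Function.notMem_support.1 fun h => (hw_supp k h).2.not_ge hτ, hwC,
    hlim⟩

theorem sub_two_mul_half_integral_inv_sqrt_pow (hσ : 0 < σ) (hσρ : σ ≤ ρ) :
    ((m : ℝ) - 2) * (1 / 2 * ∫ τ in σ ^ 2..ρ ^ 2, (√τ ^ m)⁻¹) =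
      σ ^ (2 - (m : ℤ)) - ρ ^ (2 - (m : ℤ)) := by
  have hpos : ∀ τ ∈ uIcc (σ ^ 2) (ρ ^ 2), 0 < √τ := fun τ hτ =>
    Real.sqrt_pos.2 ((pow_pos hσ 2).trans_le
      (uIcc_of_le (pow_le_pow_left₀ hσ.le hσρ 2) ▸ hτ :).1)
  have hderiv : ∀ τ ∈ uIcc (σ ^ 2) (ρ ^ 2), HasDerivAt (fun τ => -(√τ ^ (2 - (m : ℤ))))
      (((m : ℝ) - 2) * (1 / 2 * (√τ ^ m)⁻¹)) τ := by
    intro τ hτ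
    have hs := (hpos τ hτ).ne'
    refine ((hasDerivAt_zpow (2 - (m : ℤ)) √τ (.inl hs)).comp τ
      (Real.hasDerivAt_sqrt (Real.sqrt_pos.1 (hpos τ hτ)).ne')).neg.congr_deriv ?_
    have hpow : √τ ^ (2 - (m : ℤ) - 1) = √τ * (√τ ^ m)⁻¹ := by
      rw [show 2 - (m : ℤ) - 1 = 1 - m by ring, zpow_sub₀ hs, zpow_one, zpow_natCast,
        div_eq_mul_inv]
    rw [hpow]
    push_cast
    field_simp
    ring
  have hcont : ContinuousOn (fun τ => ((m : ℝ) - 2) * (1 / 2 * (√τ ^ m)⁻¹))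
      (uIcc (σ ^ 2) (ρ ^ 2)) :=
    continuousOn_const.mul (continuousOn_const.mul
      ((Real.continuous_sqrt.continuousOn.pow m).inv₀ fun τ hτ => (pow_pos (hpos τ hτ) m).ne'))
  rw [← intervalIntegral.integral_const_mul, ← intervalIntegral.integral_const_mul,
    intervalIntegral.integral_eq_sub_of_hasDerivAt hderiv hcont.intervalIntegrable,
    Real.sqrt_sq (hσ.le.trans hσρ), Real.sqrt_sq hσ.le]
  ring

theorem sub_two_mul_profile_annulusWeight (hσ : 0 < σ) (hσρ : σ ≤ ρ) (hR : 0 ≤ R) (hRρ : R ≤ ρ) :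
    ((m : ℝ) - 2) * profile (annulusWeight m σ ρ) (ρ ^ 2) (R ^ 2) =
      max R σ ^ (2 - (m : ℤ)) - ρ ^ (2 - (m : ℤ)) := by
  have hmax : max R σ ≤ ρ := max_le hRρ hσρ
  have hmax_sq : max (R ^ 2) (σ ^ 2) = max R σ ^ 2 :=
    ((pow_left_monotoneOn (n := 2)).map_max hR hσ.le).symm
  rw [← sub_two_mul_half_integral_inv_sqrt_pow (hσ.trans_le (le_max_right _ _)) hmax, profile,
    intervalIntegral.integral_of_le (pow_le_pow_left₀ hR hRρ 2),
    intervalIntegral.integral_of_le (pow_le_pow_left₀ (hR.trans (le_max_left _ _)) hmax 2)]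
  simp only [annulusWeight]
  rw [setIntegral_indicator measurableSet_Ioo, Ioc_inter_Ioo_of_right_le le_rfl, hmax_sq,
    integral_Ioc_eq_integral_Ioo]

end AnnulusWeight

variable {V F : Type*} [NormedAddCommGroup V] [InnerProductSpace ℝ V] [FiniteDimensional ℝ V]
  [NormedAddCommGroup F] [InnerProductSpace ℝ F] {x y : V} {σ ρ : ℝ}

section Integrability

variable [MeasurableSpace V] [BorelSpace V] {μ : Measure V} {g : V → V →L[ℝ] F}

theorem integrableOn_zpow_mul_norm_sq_radial [IsFiniteMeasureOnCompacts μ]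
    (hσ : 0 < σ) (hg : MemLp g 2 μ) (x : V) (ρ : ℝ) (p : ℤ) :
    IntegrableOn (fun y => ‖y - x‖ ^ p * ‖g y (‖y - x‖⁻¹ • (y - x))‖ ^ 2)
      (ball x ρ \ ball x σ) μ := by
  have hmeas : MeasurableSet (ball x ρ \ ball x σ) := measurableSet_ball.diff measurableSet_ball
  have hcont : ContinuousOn (fun y : V => ‖y - x‖ ^ p) (closedBall x ρ \ ball x σ) := by
    refine ContinuousOn.zpow₀ (by fun_prop) _ fun y hy => .inl ?_
    have hy_norm : σ ≤ ‖y - x‖ := by simpa only [mem_ball_iff_norm, not_lt] using hy.2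
    exact (hσ.trans_le hy_norm).ne'
  have hsub : ball x ρ \ ball x σ ⊆ closedBall x ρ \ ball x σ :=
    sdiff_subset_sdiff_left ball_subset_closedBall
  obtain ⟨C, hC⟩ := ((isCompact_closedBall x ρ).diff isOpen_ball).exists_bound_of_continuousOn hcont
  have hmeas_radial : AEStronglyMeasurable (fun y => ‖g y (‖y - x‖⁻¹ • (y - x))‖ ^ 2)
      (μ.restrict (ball x ρ \ ball x σ)) := by
    have hdir : Measurable fun y : V => ‖y - x‖⁻¹ • (y - x) := by fun_prop
    exact (Continuous.comp_aestronglyMeasurable (g := fun p : (V →L[ℝ] F) × V => ‖p.1 p.2‖ ^ 2)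
      (by fun_prop) (hg.1.prodMk hdir.aestronglyMeasurable)).restrict
  refine ((hg.integrable_norm_pow two_ne_zero).const_mul C).integrableOn.mono'
    (((hcont.mono hsub).aestronglyMeasurable hmeas).mul hmeas_radial) ?_
  refine (ae_restrict_mem hmeas).mono fun y hy => ?_
  have hunit : ‖g y (‖y - x‖⁻¹ • (y - x))‖ ≤ ‖g y‖ := by
    refine (g y).unit_le_opNorm _ ?_
    rw [norm_smul, norm_inv, norm_norm]
    exact inv_mul_le_one
  rw [norm_mul, norm_pow, norm_norm]
  have hCy := hC y (hsub hy)
  gcongr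
  exact (norm_nonneg _).trans hCy

end Integrability

variable [CompleteSpace F]

theorem radialDensity_annulusWeight (hσ : 0 < σ) (hσρ : σ < ρ) (hyσ : ‖y - x‖ ≠ σ)
    (g : V → V →L[ℝ] F) :
    radialDensity (annulusWeight (finrank ℝ V) σ ρ) (ρ ^ 2) (y - x) (g y) =
      (ball x σ).indicator (fun y => σ ^ (2 - (finrank ℝ V : ℤ)) * energyForm 1 (g y)) y
      - (ball x ρ).indicator (fun y => ρ ^ (2 - (finrank ℝ V : ℤ)) * energyForm 1 (g y)) y
      + (ball x ρ \ ball x σ).indicator (fun y =>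
          2 * (‖y - x‖ ^ (2 - (finrank ℝ V : ℤ)) * ‖g y (‖y - x‖⁻¹ • (y - x))‖ ^ 2)) y := by
  classical
  simp only [indicator_apply, Set.mem_sdiff, mem_ball_iff_norm]
  rcases le_or_gt ρ ‖y - x‖ with hρ | hρ
  · have hsq : ρ ^ 2 ≤ ‖y - x‖ ^ 2 := pow_le_pow_left₀ (hσ.trans hσρ).le hρ 2
    simp [radialDensity, annulusWeight_eq_zero hsq,
      profile_eq_zero (fun _ => annulusWeight_eq_zero) hsq, hρ.not_gt,
      (hσρ.le.trans hρ).not_gt]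
  · rw [radialDensity, sub_two_mul_profile_annulusWeight hσ hσρ.le (norm_nonneg _) hρ.le]
    rcases hyσ.lt_or_gt with hlt | hgt
    · simp only [hlt.le, sup_of_le_right, annulusWeight_sq_of_le (norm_nonneg _) hlt.le,
        zero_mul, sub_zero, mul_zero, add_zero, hlt, ↓reduceIte, hρ, not_true_eq_false,
        and_false]
      ring
    · have hR : 0 < ‖y - x‖ := hσ.trans hgt
      have hpow : ‖y - x‖ ^ (2 - (finrank ℝ V : ℤ)) =
          ‖y - x‖ ^ 2 * (‖y - x‖ ^ finrank ℝ V)⁻¹ := by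
        rw [zpow_sub₀ hR.ne', zpow_natCast, div_eq_mul_inv]
        norm_cast
      simp only [hgt.le, sup_of_le_left, hpow, annulusWeight_sq_of_mem hσ.le ⟨hgt, hρ⟩, map_smul,
        hgt.not_gt, ↓reduceIte, hρ, zero_sub, not_false_eq_true, and_self, norm_smul, norm_inv,
        norm_norm]
      field_simp
      ring

theorem IsStationary.monotonicity [MeasurableSpace V] [BorelSpace V] {μ : Measure V}
    {Ω : Set V} {g : V → V →L[ℝ] F} [μ.IsAddHaarMeasure] (h : IsStationary μ Ω g) (hg : MemLp g 2 μ)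
    (hσ : 0 < σ) (hσρ : σ < ρ) (hxρ : closedBall x ρ ⊆ Ω) :
    ρ ^ (2 - (finrank ℝ V : ℤ)) * ∫ y in ball x ρ, energyForm 1 (g y) ∂μ
        - σ ^ (2 - (finrank ℝ V : ℤ)) * ∫ y in ball x σ, energyForm 1 (g y) ∂μ =
      2 * ∫ y in ball x ρ \ ball x σ,
        ‖y - x‖ ^ (2 - (finrank ℝ V : ℤ)) * ‖g y (‖y - x‖⁻¹ • (y - x))‖ ^ 2 ∂μ := by
  obtain ⟨w, hw, hw_zero, hwC, hlim⟩ :=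
    exists_contDiff_tendsto_annulusWeight (m := finrank ℝ V) (ρ := ρ) hσ
  have hzero := h.integral_radialDensity_eq_zero_of_tendsto hg (hσ.trans hσρ).le hxρ hw hw_zero
    hwC hlim
  have hsphere : ∀ᵐ y ∂μ, ‖y - x‖ ≠ σ := by
    filter_upwards [measure_eq_zero_iff_ae_notMem.1
      (Measure.addHaar_sphere_of_ne_zero μ x hσ.ne')] with y hy
    rwa [mem_sphere_iff_norm] at hy
  have henergy (r c : ℝ) :
      Integrable ((ball x r).indicator fun y => c * energyForm 1 (g y)) μ :=
    ((integrable_energyForm_one hg).const_mul c).indicator measurableSet_ball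
  have hann : MeasurableSet (ball x ρ \ ball x σ) := measurableSet_ball.diff measurableSet_ball
  have hradial := IntegrableOn.integrable_indicator
    ((integrableOn_zpow_mul_norm_sq_radial hσ hg x ρ (2 - (finrank ℝ V : ℤ))).const_mul 2) hann
  rw [integral_congr_ae (hsphere.mono fun y hy => radialDensity_annulusWeight hσ hσρ hy g),
    integral_add ((henergy σ _).sub' (henergy ρ _)) hradial,
    integral_sub (henergy σ _) (henergy ρ _), integral_indicator measurableSet_ball,
    integral_indicator measurableSet_ball, integral_indicator hann, integral_const_mul,
    integral_const_mul, integral_const_mul] at hzero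
  linarith

end Monotonicity

section Sobolev

open scoped Manifold

variable {m : ℕ} {F : Type*} [NormedAddCommGroup F] [NormedSpace ℝ F] {Ω : Set (E m)}
  {f : E m → F} {g : E m → E m →L[ℝ] F}

/-- `g` is the gradient of a map `f ∈ W^{1,2}(Ω)`, extended by zero. Only the values of `f` in `Ω`
matter, so `f` enters through its extension by zero. -/
structure IsSobolevGradOn (Ω : Set (E m)) (f : E m → F) (g : E m → E m →L[ℝ] F) : Prop where
  memLp_indicator : MemLp (Ω.indicator f) 2 volume
  memLp : MemLp g 2 volume
  isWeakGradOn : IsWeakGradOn volume Ω (Ω.indicator f) g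
  eq_zero : ∀ y ∉ Ω, g y = 0

theorem memW12_iff_exists_isSobolevGradOn (hΩ : MeasurableSet Ω) :
    MemW12 Ω f ↔ ∃ g, IsSobolevGradOn Ω f g := by
  constructor
  · rintro ⟨hf, g, hg, hfg⟩
    have hfg' : IsWeakGradOn volume Ω f g := isWeakGradOn_iff_setIntegral.2 hfg
    have hfΩ : Set.EqOn f (Ω.indicator f) Ω := Set.eqOn_indicator.symm
    have hgΩ : Set.EqOn g (Ω.indicator g) Ω := Set.eqOn_indicator.symm
    exact ⟨Ω.indicator g, (memLp_indicator_iff_restrict hΩ).2 hf,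
      (memLp_indicator_iff_restrict (f := g) hΩ).2 hg, hfg'.congr hfΩ hgΩ,
      fun y hy => Set.indicator_of_notMem hy g⟩
  · rintro ⟨g, h⟩
    exact ⟨(memLp_indicator_iff_restrict hΩ).1 h.memLp_indicator, g, h.memLp.restrict Ω,
      isWeakGradOn_iff_setIntegral.1 (h.isWeakGradOn.congr Set.eqOn_indicator fun _ _ => rfl)⟩

theorem IsSobolevGradOn.comp_symm (h : IsSobolevGradOn Ω f g) {T : E m ≃ₘ[ℝ] E m}
    (hT : IsSupportedIn T Ω) :
    IsSobolevGradOn Ω (fun z => f (T.symm z)) fun z => g (T.symm z) ∘L fderiv ℝ T.symm z := by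
  have indicator_comp :
      Ω.indicator (fun z => f (T.symm z)) = fun z => Ω.indicator f (T.symm z) := by
    conv_lhs => rw [← hT.preimage_symm_eq]
    exact funext fun z => Set.indicator_comp_right (g := f) T.symm
  refine ⟨?_, hT.memLp_comp_fderiv_symm h.memLp, ?_, fun y hy => ?_⟩
  · rw [indicator_comp]
    exact hT.memLp_comp_symm h.memLp_indicator
  · have hcomp := h.isWeakGradOn.comp_symm T (h.memLp_indicator.locallyIntegrable one_le_two)
      (h.memLp.locallyIntegrable one_le_two)
    rwa [hT.preimage_symm_eq, ← indicator_comp] at hcomp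
  · rw [h.eq_zero _ fun hTy => hy (hT.preimage_symm_eq.subset hTy), ContinuousLinearMap.zero_comp]

theorem IsSobolevGradOn.ae_hasApproxFDerivAt [CompleteSpace F] (hΩ : IsOpen Ω)
    (h : IsSobolevGradOn Ω f g) :
    ∀ᵐ y ∂volume.restrict Ω, HasApproxFDerivAt volume f (g y) y := by
  rw [ae_restrict_iff' hΩ.measurableSet]
  filter_upwards [h.isWeakGradOn.ae_hasApproxFDerivAt hΩ
    (h.memLp_indicator.locallyIntegrable one_le_two) (h.memLp.locallyIntegrable one_le_two)]
    with y hy hyΩ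
  refine (hy hyΩ).congr_isLittleO (Set.indicator_of_mem hyΩ f)
    ((Asymptotics.isLittleO_zero _ _).congr' ?_ .rfl)
  filter_upwards [apNhds_le_nhds (hΩ.mem_nhds hyΩ)] with z hz
  rw [Set.indicator_of_mem hz, sub_self]

end Sobolev

section QValued

variable {m n Q K : ℕ} {b : Fin K → OrthonormalBasis (Fin n) ℝ (E n)} {u : E m → QPoint Q n}
  {Ω : Set (E m)} {g : E m → E m →L[ℝ] EuclideanSpace ℝ (Fin K × Fin n × Fin Q)}

theorem approxDifferentiableAt_and_dirDerivSq_eq_of_xi (hb : IsBiLipschitz (xi (Q := Q) b))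
    {y : E m} {G : E m →L[ℝ] EuclideanSpace ℝ (Fin K × Fin n × Fin Q)}
    (hG : HasApproxFDerivAt volume (fun z => xi b (u z)) G y) :
    ApproxDifferentiableAt u y ∧ ∀ v, dirDerivSq u y v = ‖G v‖ ^ 2 := by
  rcases K.eq_zero_or_pos with rfl | hK
  · have : Subsingleton (QPoint Q n) :=
      not_nontrivial_iff_subsingleton.1 fun _ => hb.neZero_of_xi.out rfl
    -- With no basis at all, `Q(ℝⁿ)` is a point, and any single basis may be used instead.
    let b₁ := fun _ : Fin 1 => EuclideanSpace.basisFun (Fin n) ℝ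
    have hb₁ : IsBiLipschitz (xi (Q := Q) b₁) := by
      refine ⟨1, 1, one_pos, one_pos, fun p q => ?_⟩
      rw [Subsingleton.elim p q, QPoint.gdist_self, sub_self, norm_zero, mul_zero]
      exact ⟨le_rfl, le_rfl⟩
    have hconst : HasApproxFDerivAt volume (fun z => xi b₁ (u z)) 0 y := by
      refine hasApproxFDerivAt_iff_isLittleO.2 ((Asymptotics.isLittleO_zero _ _).congr_left
        fun z => ?_)
      rw [Subsingleton.elim (u z) (u y), sub_self, zero_apply, sub_zero]
    refine ⟨approxDifferentiableAt_of_xi hb₁ hconst, fun v => ?_⟩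
    rw [dirDerivSq_eq_of_xi hb₁ hconst, Subsingleton.elim (G v) 0,
      zero_apply, norm_zero, norm_zero]
  · have : NeZero K := ⟨hK.ne'⟩
    exact ⟨approxDifferentiableAt_of_xi hb hG, dirDerivSq_eq_of_xi hb hG⟩

theorem ae_approxDifferentiableAt_and_dirDerivSq_eq (hb : IsBiLipschitz (xi (Q := Q) b))
    (hΩ : IsOpen Ω) (h : IsSobolevGradOn Ω (fun y => xi b (u y)) g) :
    ∀ᵐ y ∂volume.restrict Ω, ApproxDifferentiableAt u y ∧ ∀ v, dirDerivSq u y v = ‖g y v‖ ^ 2 :=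
  (h.ae_hasApproxFDerivAt hΩ).mono fun _ hy => approxDifferentiableAt_and_dirDerivSq_eq_of_xi hb hy

theorem derivSq_ae_eq_energyForm (hb : IsBiLipschitz (xi (Q := Q) b)) (hΩ : IsOpen Ω)
    (h : IsSobolevGradOn Ω (fun y => xi b (u y)) g) {S : Set (E m)} (hS : S ⊆ Ω) :
    derivSq u =ᵐ[volume.restrict S] fun y => energyForm 1 (g y) := by
  filter_upwards [ae_mono (Measure.restrict_mono hS le_rfl)
    (ae_approxDifferentiableAt_and_dirDerivSq_eq hb hΩ h)] with y hy
  simp only [energyForm_one_eq_sum (EuclideanSpace.basisFun (Fin m) ℝ), derivSq, hy.2,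
    EuclideanSpace.basisFun_apply]

theorem radialDerivSq_ae_eq_norm_sq (hb : IsBiLipschitz (xi (Q := Q) b)) (hΩ : IsOpen Ω)
    (h : IsSobolevGradOn Ω (fun y => xi b (u y)) g) {S : Set (E m)} (hS : S ⊆ Ω) (x : E m) :
    radialDerivSq u x =ᵐ[volume.restrict S] fun y => ‖g y (‖y - x‖⁻¹ • (y - x))‖ ^ 2 := by
  filter_upwards [ae_mono (Measure.restrict_mono hS le_rfl)
    (ae_approxDifferentiableAt_and_dirDerivSq_eq hb hΩ h)] with y hy
  exact hy.2 _

theorem dirEnergy_eq_ofReal_integral (hb : IsBiLipschitz (xi (Q := Q) b)) (hΩ : IsOpen Ω)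
    (h : IsSobolevGradOn Ω (fun y => xi b (u y)) g) :
    dirEnergy u Ω = ENNReal.ofReal (∫ y, energyForm 1 (g y)) := by
  have energy_eq_zero : ∀ y ∉ Ω, energyForm 1 (g y) = 0 := fun y hy => by
    simp only [energyForm_one_eq_sum (EuclideanSpace.basisFun (Fin m) ℝ), h.eq_zero y hy,
      zero_apply, norm_zero, zero_pow two_ne_zero, Finset.sum_const_zero]
  rw [← setIntegral_eq_integral_of_forall_compl_eq_zero energy_eq_zero,
    ofReal_integral_eq_lintegral_ofReal (integrable_energyForm_one h.memLp).integrableOn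
      (.of_forall fun y => energyForm_one_nonneg (g y))]
  exact lintegral_congr_ae
    ((derivSq_ae_eq_energyForm hb hΩ h subset_rfl).fun_comp ENNReal.ofReal)

/-- `u` belongs to the class `𝒴₂(Ω, Q(A))` of the `Q`-valued maps `u` with values in `A` for which
`ξ ∘ u ∈ W^{1,2}(Ω)`. -/
def MemY2 (A : Set (E n)) (Ω : Set (E m)) (u : E m → QPoint Q n) : Prop :=
  (∀ᵐ y ∂volume.restrict Ω, ∀ p ∈ u y, p ∈ A) ∧
  ∃ (K : ℕ) (b : Fin K → OrthonormalBasis (Fin n) ℝ (E n)),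
    IsBiLipschitz (xi (Q := Q) b) ∧ MemW12 Ω (fun y => xi b (u y))

/-- `u` has least Dirichlet energy in `Ω` among the maps with values in `A` that agree with it near
`∂Ω`. -/
def IsDirMinimizingOn (A : Set (E n)) (Ω : Set (E m)) (u : E m → QPoint Q n) : Prop :=
  MemY2 A Ω u ∧
  ∀ v, MemY2 A Ω v →
    (∃ K ⊆ Ω, IsCompact K ∧ ∀ᵐ y ∂volume.restrict (Ω \ K), v y = u y) →
    dirEnergy u Ω ≤ dirEnergy v Ω

variable {A : Set (E n)}

theorem IsDirMinimizingOn.isInnerMinimizing (hu : IsDirMinimizingOn A Ω u)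
    (hb : IsBiLipschitz (xi (Q := Q) b)) (hΩ : IsOpen Ω)
    (h : IsSobolevGradOn Ω (fun y => xi b (u y)) g) : IsInnerMinimizing volume Ω g := by
  intro T hT
  have hv := h.comp_symm hT
  have memY2 : MemY2 A Ω fun z => u (T.symm z) := by
    refine ⟨?_, K, b, hb, (memW12_iff_exists_isSobolevGradOn hΩ.measurableSet).2 ⟨_, hv⟩⟩
    have hA := hu.1.1
    rw [ae_restrict_iff' hΩ.measurableSet] at hA ⊢
    filter_upwards [hT.ae_comp_symm hA] with z hz hzΩ
    exact hz (hT.preimage_symm_eq.superset hzΩ)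
  have agree : ∃ S ⊆ Ω, IsCompact S ∧ ∀ᵐ y ∂volume.restrict (Ω \ S), u (T.symm y) = u y := by
    obtain ⟨S, hSΩ, hS, hTS⟩ := hT.symm
    refine ⟨S, hSΩ, hS, ?_⟩
    filter_upwards [ae_restrict_mem (hΩ.measurableSet.diff hS.measurableSet)] with y hy
    rw [hTS y hy.2]
  have hle := hu.2 _ memY2 agree
  rwa [dirEnergy_eq_ofReal_integral hb hΩ h, dirEnergy_eq_ofReal_integral hb hΩ hv,
    ENNReal.ofReal_le_ofReal_iff (integral_nonneg fun y => energyForm_one_nonneg _)] at hle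

theorem IsDirMinimizing.isDirMinimizingOn (hu : IsDirMinimizing u) :
    IsDirMinimizingOn (Metric.sphere 0 1) (Metric.ball 0 1) u := by
  have memY2_iff (v : E m → QPoint Q n) :
      MemY2 (Metric.sphere 0 1) (Metric.ball 0 1) v ↔ MemY2Sphere (Metric.ball 0 1) v := by
    simp only [MemY2, MemY2Sphere, mem_sphere_zero_iff_norm]
  refine ⟨(memY2_iff u).2 hu.1, fun v hv ⟨K, hKΩ, hK, hvu⟩ => hu.2 v ((memY2_iff v).1 hv) ?_⟩
  obtain ⟨r, hr, hKr⟩ := exists_lt_subset_ball hK.isClosed hKΩ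
  exact ⟨r, hr, ae_mono (Measure.restrict_mono (Set.sdiff_subset_sdiff_right hKr) le_rfl) hvu⟩

end QValued

end MultiValued

open MultiValued in
theorem theorem9p1_general {m n Q : ℕ} {A : Set (E n)} {Ω : Set (E m)} (hΩ : IsOpen Ω)
    {u : E m → QPoint Q n} (hu : IsDirMinimizingOn A Ω u) {x : E m} {σ ρ : ℝ} (hσ : 0 < σ)
    (hσρ : σ < ρ) (hxρ : Metric.closedBall x ρ ⊆ Ω) :
    (∀ᵐ y ∂volume.restrict Ω, ApproxDifferentiableAt u y) ∧
    IntegrableOn (derivSq u) (Metric.ball x ρ) ∧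
    IntegrableOn (fun y => ‖y - x‖ ^ (2 - (m : ℤ)) * radialDerivSq u x y)
      (Metric.ball x ρ \ Metric.ball x σ) ∧
    ρ ^ (2 - (m : ℤ)) * (∫ y in Metric.ball x ρ, derivSq u y)
        - σ ^ (2 - (m : ℤ)) * (∫ y in Metric.ball x σ, derivSq u y)
      = 2 * ∫ y in Metric.ball x ρ \ Metric.ball x σ,
          ‖y - x‖ ^ (2 - (m : ℤ)) * radialDerivSq u x y := by
  obtain ⟨K, b, hb, hW12⟩ := hu.1.2
  obtain ⟨g, hg⟩ := (memW12_iff_exists_isSobolevGradOn hΩ.measurableSet).1 hW12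
  have hρΩ : Metric.ball x ρ ⊆ Ω := Metric.ball_subset_closedBall.trans hxρ
  have energy_ρ := derivSq_ae_eq_energyForm hb hΩ hg hρΩ
  have energy_σ :=
    derivSq_ae_eq_energyForm hb hΩ hg ((Metric.ball_subset_ball hσρ.le).trans hρΩ)
  have radial := (EventuallyEq.refl _ fun y => ‖y - x‖ ^ (2 - (m : ℤ))).fun_mul
    (radialDerivSq_ae_eq_norm_sq hb hΩ hg
      (Set.sdiff_subset (t := Metric.ball x σ) |>.trans hρΩ) x)
  refine ⟨(ae_approxDifferentiableAt_and_dirDerivSq_eq hb hΩ hg).mono fun y hy => hy.1,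
    (integrable_energyForm_one hg.memLp).integrableOn.congr energy_ρ.symm,
    (integrableOn_zpow_mul_norm_sq_radial hσ hg.memLp x ρ _).congr radial.symm, ?_⟩
  rw [integral_congr_ae energy_ρ, integral_congr_ae energy_σ, integral_congr_ae radial]
  have stationary := (hu.isInnerMinimizing hb hΩ hg).isStationary hg.memLp
  simpa only [finrank_euclideanSpace_fin] using stationary.monotonicity hg.memLp hσ hσρ hxρ

theorem theorem9p1 (m n Q : ℕ) (hm : 2 ≤ m) (hn : 2 ≤ n)
    (u : MultiValued.E m → MultiValued.QPoint Q n) (hu : MultiValued.IsDirMinimizing u)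
    (x : MultiValued.E m) (ρ₀ : ℝ)
    (hball : Metric.ball x ρ₀ ⊆ Metric.ball (0 : MultiValued.E m) 1)
    (σ ρ : ℝ) (hσ : 0 < σ) (hσρ : σ < ρ) (hρ : ρ < ρ₀) :
    (∀ᵐ y ∂(volume.restrict (Metric.ball (0 : MultiValued.E m) 1)),
      MultiValued.ApproxDifferentiableAt u y) ∧
    IntegrableOn (fun y => MultiValued.derivSq u y) (Metric.ball x ρ) volume ∧
    IntegrableOn (fun y => ‖y - x‖ ^ (2 - (m : ℤ)) * MultiValued.radialDerivSq u x y)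
      (Metric.ball x ρ \ Metric.ball x σ) volume ∧
    ρ ^ (2 - (m : ℤ)) * (∫ y in Metric.ball x ρ, MultiValued.derivSq u y)
        - σ ^ (2 - (m : ℤ)) * (∫ y in Metric.ball x σ, MultiValued.derivSq u y)
      = 2 * ∫ y in Metric.ball x ρ \ Metric.ball x σ,
          ‖y - x‖ ^ (2 - (m : ℤ)) * MultiValued.radialDerivSq u x y :=
  theorem9p1_general Metric.isOpen_ball hu.isDirMinimizingOn hσ hσρ
    ((Metric.closedBall_subset_ball hρ).trans hball)
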